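/- **Theorem 2 (reduced wave function for spontaneous localization).** Let $\mathcal H$ be a complex Hilbert space, $\hbar,\kappa,\nu>0$, let $H$ be a self-adjoint operator in $\mathcal H$ and $U(t)=e^{-iHt/\hbar}$. Let $\mathbf R=(R^1,\dots,R^d)$ be self-adjoint operators in $\mathcal H$ such that for each $p\in\mathbb R^d$ the operator $p\cdot\mathbf R=\sum_\alpha p_\alpha R^\alpha$ is essentially self-adjoint on the intersection of the domains of the summands and $p\mapsto e^{-isp\cdot\mathbf R/\hbar}$ is strongly measurable for each $s\in\mathbb R$ (both hold whenever the $R^\alpha$ commute strongly). Let $\Lambda=\mathbb R^d$ with Lebesgue measure $\lambda$, or $\Lambda=\varepsilon\mathbb Z^d$, $\varepsilon>0$, with mass $\varepsilon^d$ at each point. Let $f_0:\Lambda\to\mathbb C$ satisfy $\int|f_0|^2d\lambda=1$ and $f_0\ne0$ almost everywhere, and put $d\mu_0=|f_0|^2d\lambda$. Let $S=\exp\{-\tfrac i\hbar\kappa\,\mathbf R\otimes\mathbf P\}$ be the scattering operator on $\mathcal H\otimes L^2(\Lambda)=L^2(\Lambda;\mathcal H)$, i.e. multiplication by $e^{-i\kappa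 p\cdot\mathbf R/\hbar}$ in the representation in which the pointer momentum $\mathbf P$ is multiplication by $p$ ($p\in\mathbb R^d$ if $\Lambda=\mathbb R^d$, and $p\in[-\pi\hbar/\varepsilon,\pi\hbar/\varepsilon)^d$ if $\Lambda=\varepsilon\mathbb Z^d$). For $y\in\Lambda$ let $$G(y)\zeta=\langle y|S(\zeta\otimes f_0)=\frac{1}{f_0(y)}\,\bigl(S(\zeta\otimes f_0)\bigr)(y),$$ an operator, in general unbounded, whose domain is the set of $\zeta\in\mathcal H$ for which the value at $y$ exists as the limit of averages of $S(\zeta\otimes f_0)$ over small balls about $y$. Let $\Gamma_\infty$ be the set of sequences $\tau=(0<t_1<t_2<\cdots)$ with $t_n\to\infty$, let $n_t(\tau)$ be the number of $n$ with $t_n<t$, and let $\pi_0$ be the Poisson law of intensity $\nu$ on $\Gamma_\infty$: the restriction of $\tau$ to $[0,t)$ has the law $e^{-\nu t}\nu^n\,dt_1\cdots dt_n$ on the simplices $0\le t_1<\dots<t_n<t$, $n=0,1,\dots$. On $\Upsilon_\infty=\Gamma_\infty\times\Lambda^\infty$, with points $\upsilon=(\tau,(y_1,y_2,\dots))$, let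 $P_0=\pi_0\otimes\mu_0^{\infty}$. For a unit vector $\eta\in\mathcal H$ let $$\chi(t,\upsilon)=T(t,\upsilon)\eta=U(t)\,G(t_n,y_n)\cdots G(t_1,y_1)\,\eta,\qquad n=n_t(\tau),\quad G(r,y)=U(r)^\dagger G(y)U(r)$$ (where a vector lies outside the domain of a factor, which happens only for $\upsilon$ in a $P_0$-null set, that factor is given the value $0$). Then: 1. For every $\tau\in\Gamma_\infty$ and $t\ge0$, for almost all $(y_n)$, $\chi(t,\upsilon)=\langle y_1,y_2,\dots|\,U(t,\tau)(\eta\otimes\varphi_0)$, where $\langle y_1,y_2,\dots|$ denotes the value at $(y_n)$ of a vector of $L^2(\Lambda^\infty,\mu_0^\infty;\mathcal H)$, $\varphi_0\equiv1$ represents $f_0^{\otimes\infty}$, and $U(t,\tau)$ is the unitary evolution in this space given by the free evolution $U$ between the kicks and, at the time $t_n$, by $S$ acting on the $n$-th pointer, where $L^2(\mu_0)$ is identified with $L^2(\lambda)$ through multiplication by $f_0$. 2. For every $t\ge0$ the random vector $\chi(t)$ is square integrable and $\int\|\chi(t,\upsilon)\|^2P_0(d\upsilon)=1$. 3. For $P_0$-almost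 every $\upsilon$ the path $t\mapsto\chi(t,\upsilon)$, $t\ge0$, satisfies the stochastic wave equation $$d\chi(t)+\tfrac i\hbar H\chi(t)\,dt=dn_t[G-I]\,\chi(t),\qquad\chi(0)=\eta,$$ with forward differentials. That is: it starts at $\eta$, it is left continuous with right limits, $\chi(t_n)$ lies in the domain of $G(y_n)$ for all $n$, and for every $\varphi$ in the domain of $H$ and every $t\ge0$ $$\langle\varphi,\chi(t)\rangle-\langle\varphi,\eta\rangle+\tfrac i\hbar\int_0^t\langle H\varphi,\chi(s)\rangle ds=\sum_{t_n<t}\langle\varphi,(G(y_n)-I)\chi(t_n)\rangle .$$ It also satisfies the integral form $\chi(t)=e^{-iHt/\hbar}\bigl(\eta+\sum_{t_n<t}e^{iHt_n/\hbar}(G(y_n)-I)\chi(t_n)\bigr)$ of this equation, and it is the only solution of either form: every path for which the values before the kicks lie in the domains of the $G(y_n)$ and which solves the integral form, or which has all the properties listed for the differential form, coincides with $\chi(\cdot,\upsilon)$ on $[0,\infty)$. -/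

import Mathlib

open MeasureTheory Filter Topology Set
open scoped FourierTransform InnerProductSpace ENNReal

noncomputable section

namespace SpontLoc

/-! ### Unitary groups and unbounded generators -/

section Groups

variable {H : Type*} [NormedAddCommGroup H] [InnerProductSpace ℂ H]

/-- `U t = exp (-(i/ħ) t A)`: a strongly continuous one-parameter group of unitary operators whose
generator is `-(i/ħ) A`, with exact domain (this makes `A` self-adjoint and determines `U`). -/
structure IsUnitaryGroup (ħ : ℝ) (A : H →ₗ.[ℂ] H) (U : ℝ → (H ≃ₗᵢ[ℂ] H)) : Prop where
  zero : ∀ x, U 0 x = x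
  add : ∀ s t x, U (s + t) x = U s (U t x)
  continuous : ∀ x, Continuous fun t => U t x
  generator : ∀ x y, (x, y) ∈ A.graph ↔
    HasDerivAt (fun t => U t x) (-(Complex.I / (ħ : ℂ)) • y) 0

/-- `V p s = exp (-(i/ħ) s (p · R))` for a vector operator `R = (R¹, …, R^d)` and a numerical vector
`p`; here `p · R` is the closure of `∑ p_α R^α`, and `p ↦ V p s` is a measurable family of unitary
operators. -/
structure IsVectorExponential {d : ℕ} (ħ : ℝ) (R : Fin d → (H →ₗ.[ℂ] H))
    (V : EuclideanSpace ℝ (Fin d) → ℝ → (H ≃ₗᵢ[ℂ] H)) : Prop where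
  group : ∀ p, IsUnitaryGroup ħ (∑ α, ((p α : ℝ) : ℂ) • R α).closure (V p)
  measurable : ∀ s ζ, StronglyMeasurable fun p => V p s ζ

end Groups

/-! ### The pointer scale `Λ` and the state of the pointer -/

/-- The pointer scale: `Λ = ℝ^d` or the lattice `Λ = ε ℤ^d` with `ε > 0`. -/
inductive PointerScale where
  | continuum : PointerScale
  | lattice (ε : ℝ) (hε : 0 < ε) : PointerScale

/-- The point `ε k` of the lattice `ε ℤ^d ⊆ ℝ^d`. -/
def latticePoint {d : ℕ} (ε : ℝ) (k : Fin d → ℤ) : EuclideanSpace ℝ (Fin d) :=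
  WithLp.toLp 2 fun α => ε * (k α : ℝ)

/-- The measure `dλ`, regarded as a measure on `ℝ^d`: Lebesgue measure for `Λ = ℝ^d`, and mass `ε^d`
at every point of the lattice for `Λ = ε ℤ^d`. Functions on `Λ` are functions on `ℝ^d` modulo
`λ`-null sets. -/
def PointerScale.measure (d : ℕ) : PointerScale → Measure (EuclideanSpace ℝ (Fin d))
  | .continuum => volume
  | .lattice ε _ =>
      Measure.sum fun k : Fin d → ℤ => ENNReal.ofReal (ε ^ d) • Measure.dirac (latticePoint ε k)

/-- The initial state of one pointer: a function `f₀` with `∫ |f₀|² dλ = 1` and `f₀ ≠ 0` almost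
everywhere. -/
structure PointerState (d : ℕ) (Λ : PointerScale) where
  /-- the wave function -/
  f₀ : EuclideanSpace ℝ (Fin d) → ℂ
  aestronglyMeasurable : AEStronglyMeasurable f₀ (Λ.measure d)
  norm_sq : ∫⁻ y, ‖f₀ y‖ₑ ^ 2 ∂(Λ.measure d) = 1
  ne_zero : ∀ᵐ y ∂(Λ.measure d), f₀ y ≠ 0

/-- The initial pointer distribution `dμ₀ = |f₀|² dλ`. -/
def PointerState.law {d : ℕ} {Λ : PointerScale} (f : PointerState d Λ) :
    Measure (EuclideanSpace ℝ (Fin d)) :=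
  (Λ.measure d).withDensity fun y => ‖f.f₀ y‖ₑ ^ 2

instance {d : ℕ} {Λ : PointerScale} (f : PointerState d Λ) : IsProbabilityMeasure f.law :=
  ⟨by rw [PointerState.law, withDensity_apply _ MeasurableSet.univ, Measure.restrict_univ,
    f.norm_sq]⟩

/-- The law `μ₀^∞` of an infinite sequence of independent pointer values. -/
def PointerState.lawSeq {d : ℕ} {Λ : PointerScale} (f : PointerState d Λ) :
    Measure (ℕ → EuclideanSpace ℝ (Fin d)) :=
  Measure.infinitePi fun _ => f.law

/-! ### The scattering operator `S = exp (-(i/ħ) κ R ⊗ P)` on `L²(Λ; H) = H ⊗ L²(Λ)` -/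

section Scattering

variable {H : Type*} [NormedAddCommGroup H] [InnerProductSpace ℂ H] {d : ℕ}

open Classical in
/-- The class in `L²(μ; H)` of a square integrable function (and `0` for any other function). -/
def toL2 {X : Type*} [MeasurableSpace X] (μ : Measure X) (ψ : X → H) : Lp H 2 μ :=
  if h : MemLp ψ 2 μ then h.toLp ψ else 0

/-- The momentum range `[-πħ/ε, πħ/ε)^d` of a pointer on the lattice `ε ℤ^d`. -/
def momentumBox (d : ℕ) (ħ ε : ℝ) : Set (EuclideanSpace ℝ (Fin d)) :=
  {p | ∀ α, -(Real.pi * ħ / ε) ≤ p α ∧ p α < Real.pi * ħ / ε}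

/-- On the lattice, the matrix element
`(y|S|q) = (2πħ)^{-d} ∫ exp (i (y - q) · p / ħ) exp (-(i/ħ) κ p · R) dp` with `z = y - q`, applied to
`ζ`; here `W p = exp (-(i/ħ) κ p · R)`. -/
def latticeKernel (ħ ε : ℝ) (W : EuclideanSpace ℝ (Fin d) → (H ≃ₗᵢ[ℂ] H))
    (z : EuclideanSpace ℝ (Fin d)) (ζ : H) : H :=
  (((2 * Real.pi * ħ) ^ d)⁻¹ : ℝ) • ∫ p in momentumBox d ħ ε,
    Complex.exp (Complex.I * ((inner ℝ z p / ħ : ℝ) : ℂ)) • W p ζ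

variable [CompleteSpace H]

/-- The scattering operator `S = exp (-(i/ħ) κ R ⊗ P)`, where `W p = exp (-(i/ħ) κ p · R)`: in the
momentum representation of the pointer it is multiplication by `p ↦ W p`. For `Λ = ℝ^d` the momentum
is `p = 2πħξ` in terms of the Fourier variable `ξ`; for `Λ = ε ℤ^d` the operator is written through
its matrix elements. The result is a function representing a class modulo `λ`-null sets. -/
def scatter (ħ : ℝ) (Λ : PointerScale) (W : EuclideanSpace ℝ (Fin d) → (H ≃ₗᵢ[ℂ] H))
    (ψ : EuclideanSpace ℝ (Fin d) → H) : EuclideanSpace ℝ (Fin d) → H :=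
  match Λ with
  | .continuum =>
      let ψhat : Lp H 2 (volume : Measure (EuclideanSpace ℝ (Fin d))) := 𝓕 (toL2 volume ψ)
      let φ : Lp H 2 (volume : Measure (EuclideanSpace ℝ (Fin d))) :=
        𝓕⁻ (toL2 volume fun ξ => W ((2 * Real.pi * ħ) • ξ) (ψhat ξ))
      fun y => φ y
  | .lattice ε _ =>
      fun y => ∑' k : Fin d → ℤ,
        ε ^ d • latticeKernel ħ ε W (y - latticePoint ε k) (ψ (latticePoint ε k))

/-! ### The generalized bra `(y|` and the single-point reduction `G(y) = ⟨y|S f₀` -/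

/-- `v = (y|ψ`: the value at `y` of a class `ψ` modulo `λ`-null sets, as the limit of its averages
over small balls around `y`. (For locally integrable `ψ` this is the value of any representative
at `λ`-almost every `y`; on a lattice it is the value at each lattice point.) -/
def HasPointValue (Λ : PointerScale) (ψ : EuclideanSpace ℝ (Fin d) → H)
    (y : EuclideanSpace ℝ (Fin d)) (v : H) : Prop :=
  Tendsto (fun r : ℝ => ⨍ z in Metric.closedBall y r, ψ z ∂(Λ.measure d)) (𝓝[>] 0) (𝓝 v)

open Classical in
/-- The value `(y|ψ` if it exists, and `0` otherwise. -/
def pointValue (Λ : PointerScale) (ψ : EuclideanSpace ℝ (Fin d) → H)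
    (y : EuclideanSpace ℝ (Fin d)) : H :=
  if h : ∃ v, HasPointValue Λ ψ y v then h.choose else 0

/-- `ζ` belongs to the domain of the (in general unbounded) operator `G(y)`. -/
def InDomainG (ħ : ℝ) {Λ : PointerScale} (W : EuclideanSpace ℝ (Fin d) → (H ≃ₗᵢ[ℂ] H))
    (f : PointerState d Λ) (y : EuclideanSpace ℝ (Fin d)) (ζ : H) : Prop :=
  ∃ v, HasPointValue Λ (scatter ħ Λ W fun z => f.f₀ z • ζ) y v

/-- The single-point reduction `G(y) ζ = ⟨y|S (ζ ⊗ f₀)`, where `|y⟩ = |y) / f₀(y)`. -/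
def reductionG (ħ : ℝ) {Λ : PointerScale} (W : EuclideanSpace ℝ (Fin d) → (H ≃ₗᵢ[ℂ] H))
    (f : PointerState d Λ) (y : EuclideanSpace ℝ (Fin d)) (ζ : H) : H :=
  (f.f₀ y)⁻¹ • pointValue Λ (scatter ħ Λ W fun z => f.f₀ z • ζ) y

end Scattering

/-! ### Kick times, the Poisson law, counting integrals -/

/-- `Γ_∞`: infinite subsets of `(0, ∞)` with finitely many points in every `[0, t)`, listed in
increasing order; `τ n` is the time of the kick number `n + 1`. -/
def KickTimes : Type :=
  {τ : ℕ → ℝ // (∀ n, 0 < τ n) ∧ StrictMono τ ∧ Tendsto τ atTop atTop}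

instance : MeasurableSpace KickTimes := inferInstanceAs (MeasurableSpace (Subtype _))

instance : CoeFun KickTimes fun _ => ℕ → ℝ := ⟨Subtype.val⟩

/-- The number `n_t(τ) = |τ ∩ [0, t)|` of kicks before the time `t`. -/
def kickCount (τ : KickTimes) (t : ℝ) : ℕ := {n | τ n < t}.ncard

/-- The Poisson law of intensity `ν`: for every `t`, the restriction `τ ∩ [0, t)` has the law
`exp (-ν t) ν^n dt₁ ⋯ dtₙ` on the simplices `0 ≤ t₁ < ⋯ < tₙ < t`, `n = 0, 1, 2, …`. -/
structure IsPoissonLaw (ν : ℝ) (π₀ : Measure KickTimes) : Prop where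
  isProbabilityMeasure : IsProbabilityMeasure π₀
  restrict : ∀ t : ℝ, 0 ≤ t → ∀ (n : ℕ) (A : Set (Fin n → ℝ)), MeasurableSet A →
    π₀ {τ | kickCount τ t = n ∧ (fun i : Fin n => τ i) ∈ A} =
      ENNReal.ofReal (Real.exp (-(ν * t)) * ν ^ n) *
        volume (A ∩ {s | StrictMono s ∧ ∀ i, 0 ≤ s i ∧ s i < t})

/-- The space `Υ_∞ = Γ_∞ × Λ^∞` of the point trajectories `υ = (τ, y)`. -/
abbrev Trajectory (d : ℕ) : Type := KickTimes × (ℕ → EuclideanSpace ℝ (Fin d))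

/-- The initial probability `P₀ = π₀ ⊗ μ₀^∞`. -/
def initialLaw {d : ℕ} {Λ : PointerScale} (π₀ : Measure KickTimes) (f : PointerState d Λ) :
    Measure (Trajectory d) :=
  π₀.prod f.lawSeq

section Dynamics

variable {H : Type*} [NormedAddCommGroup H] [InnerProductSpace ℂ H] {d : ℕ}

/-- The counting integral `∫_0^t ∫ L(r, y) dn_r(dy)`: the sum of `L` over the points `(r, y)` of `υ`
with `r < t`. -/
def countingIntegral {M : Type*} [AddCommMonoid M] (υ : Trajectory d) (t : ℝ)
    (L : ℝ → EuclideanSpace ℝ (Fin d) → M) : M :=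
  ∑ n ∈ Finset.range (kickCount υ.1 t), L (υ.1 n) (υ.2 n)

/-- The chronological product `G(t_n, y_n) ⋯ G(t_1, y_1) η` of the first `n` single-point reductions
`G(r, y) = U(r)† G(y) U(r)`, the last one standing on the left. -/
def chronProduct (U : ℝ → (H ≃ₗᵢ[ℂ] H)) (G : EuclideanSpace ℝ (Fin d) → H → H) (υ : Trajectory d)
    (η : H) : ℕ → H
  | 0 => η
  | n + 1 => (U (υ.1 n)).symm (G (υ.2 n) (U (υ.1 n) (chronProduct U G υ η n)))

/-- The reduced wave function `χ(t, υ) = T(t, υ) η = U(t) F_t†(υ) η`, where `F_t†(υ)` is the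
chronological product of the reductions at the points `(r, y)` of `υ` with `r < t`. -/
def reducedWave (U : ℝ → (H ≃ₗᵢ[ℂ] H)) (G : EuclideanSpace ℝ (Fin d) → H → H) (η : H) (t : ℝ)
    (υ : Trajectory d) : H :=
  U t (chronProduct U G υ η (kickCount υ.1 t))

/-- A path `x` solves `dx + (i/ħ) H x dt = dn_t[G - I] x`, `x(0) = η`, along `υ` (forward
differentials): it is left continuous with right limits, its value before each kick belongs to the
domain of the corresponding reduction, and the integrated equation holds when tested against every
vector of the domain of the Hamiltonian. -/
structure SolvesWaveEquation (ħ : ℝ) (Ham : H →ₗ.[ℂ] H)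
    (D : EuclideanSpace ℝ (Fin d) → H → Prop) (G : EuclideanSpace ℝ (Fin d) → H → H)
    (η : H) (υ : Trajectory d) (x : ℝ → H) : Prop where
  initial : x 0 = η
  left_continuous : ∀ t, 0 < t → ContinuousWithinAt x (Iic t) t
  right_limit : ∀ t, 0 ≤ t → ∃ v, Tendsto x (𝓝[>] t) (𝓝 v)
  mem_domain : ∀ n, D (υ.2 n) (x (υ.1 n))
  equation : ∀ (φ : Ham.domain) (t : ℝ), 0 ≤ t →
    inner ℂ (φ : H) (x t) - inner ℂ (φ : H) η
        + Complex.I / (ħ : ℂ) * ∫ s in (0 : ℝ)..t, inner ℂ (Ham φ) (x s) =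
      countingIntegral υ t fun r y => inner ℂ (φ : H) (G y (x r) - x r)

/-- The integral form
`x(t) = exp (-(i/ħ) H t) (η + ∫_0^t ∫ exp ((i/ħ) H r) (G(y) - I) x(r) dn_r(dy))` of the same equation,
with `U t = exp (-(i/ħ) H t)`. -/
structure SolvesIntegralEquation (U : ℝ → (H ≃ₗᵢ[ℂ] H))
    (D : EuclideanSpace ℝ (Fin d) → H → Prop) (G : EuclideanSpace ℝ (Fin d) → H → H)
    (η : H) (υ : Trajectory d) (x : ℝ → H) : Prop where
  mem_domain : ∀ n, D (υ.2 n) (x (υ.1 n))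
  equation : ∀ t : ℝ, 0 ≤ t →
    x t = U t (η + countingIntegral υ t fun r y => (U r).symm (G y (x r) - x r))

/-! ### The unitary evolution of the particle with the bubbles -/

variable [CompleteSpace H]

/-- `ψ' = S(n) ψ` in `H ⊗ 𝓔_∞ = L²(Λ^∞, μ₀^∞; H)`: the scattering operator acts on the coordinate of
the bubble number `n`, where `L²(Λ)` is identified with `L²(μ₀)` through division by `f₀`. -/
def IsScattered (ħ : ℝ) {Λ : PointerScale} (W : EuclideanSpace ℝ (Fin d) → (H ≃ₗᵢ[ℂ] H))
    (f : PointerState d Λ) (n : ℕ) (ψ ψ' : (ℕ → EuclideanSpace ℝ (Fin d)) → H) : Prop :=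
  ∀ᵐ y ∂f.lawSeq,
    (fun z => f.f₀ z • ψ' (Function.update y n z)) =ᵐ[Λ.measure d]
      scatter ħ Λ W fun z => f.f₀ z • ψ (Function.update y n z)

/-- `ψ` is the state `U(t, τ) (η ⊗ φ₀)` at the time `t` of the particle with the bubbles in
`L²(Λ^∞, μ₀^∞; H)`, where `φ₀ = f₀^∞` is the constant function `1`: the free evolution `U` between
the kicks, and `S(n)` at the kick number `n`. The state just before the time `t` is `U(t) Ψ n`, with
`n = n_t(τ)`. -/
def IsUnitaryEvolution (ħ : ℝ) {Λ : PointerScale} (U : ℝ → (H ≃ₗᵢ[ℂ] H))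
    (W : EuclideanSpace ℝ (Fin d) → (H ≃ₗᵢ[ℂ] H)) (f : PointerState d Λ) (η : H) (τ : KickTimes)
    (t : ℝ) (ψ : (ℕ → EuclideanSpace ℝ (Fin d)) → H) : Prop :=
  ∃ Ψ : ℕ → (ℕ → EuclideanSpace ℝ (Fin d)) → H,
    (∀ n, MemLp (Ψ n) 2 f.lawSeq) ∧
    (Ψ 0 =ᵐ[f.lawSeq] fun _ => η) ∧
    (∀ n, IsScattered ħ W f n (fun y => U (τ n) (Ψ n y)) (fun y => U (τ n) (Ψ (n + 1) y))) ∧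
    ψ =ᵐ[f.lawSeq] fun y => U t (Ψ (kickCount τ t) y)

end Dynamics

end SpontLoc

end

/-!
The scattering operator enters only through the vectors `S (ζ ⊗ f₀)`, and the key fact is that
`ζ ↦ S (ζ ⊗ f₀)` is a linear isometry `A : H → L²(Λ; H)` (`exists_linearIsometry_scatter`). For
`Λ = ℝ^d` it is a composition of the Fourier isometries with multiplication by the measurable family
`W p` of unitary operators. For `Λ = ε ℤ^d` the values on the lattice are the Fourier coefficients of
the function `F(t) W(t) ζ` on the torus, where `F` is the Fourier series with coefficients `f₀`, and
Parseval's identity holds for functions with values in a Hilbert space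
(`tsum_enorm_integral_sq`). No separability of `H` is needed: all functions that occur are strongly
measurable.

By Lebesgue differentiation (with the Besicovitch covering theorem, which covers both measures `λ`)
the point values of `A ζ` exist almost everywhere and represent `A ζ`. If `ζ` is itself a random
vector `u`, independent of `y`, the point value exists for almost all pairs and is jointly measurable
(`ae_prod_hasPointValue`): the averages over a ball of radius `r` are continuous in `u`, measurable in
`y` and right continuous in `r`, so that their convergence is a condition on rational radii. Hence
`G(y) u` is defined almost surely and `∫ ‖G(y) u‖² dμ₀(y) = ‖u‖²` (`reductionG_prod`). As the pointer
value `n` is independent of the earlier ones, induction on the number of kicks gives the measurability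
and the normalization of the chronological product (`chronProduct_prod`).

The remaining statements hold for each trajectory on which all reductions are defined. The integral
equation determines the jumps recursively, which yields existence and uniqueness. A path of the
integral form solves the differential form, since it is a superposition of free evolutions that start
at the kicks (`IsUnitaryGroup.kickPath_weak_equation`). Conversely, for a solution of the
differential form the difference from the path of the integral form with the same jumps is a weak
solution of the free Schrödinger equation with initial value zero, and such a solution vanishes
(`IsUnitaryGroup.eq_zero_of_weak_solution`).
-/

noncomputable section

namespace SpontLoc

/-! ### Parseval's identity for vector-valued functions -/

section Parseval

theorem tsum_enorm_inner_sq {ι E : Type*} [NormedAddCommGroup E] [InnerProductSpace ℂ E]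
    (b : HilbertBasis ι ℂ E) (x : E) : ∑' i, ‖inner ℂ (b i) x‖ₑ ^ 2 = ‖x‖ₑ ^ 2 := by
  have h := lp.hasSum_norm (by norm_num : (0 : ℝ) < (2 : ℝ≥0∞).toReal) (b.repr x)
  simp only [ENNReal.toReal_ofNat, Real.rpow_ofNat, LinearIsometryEquiv.norm_map,
    HilbertBasis.repr_apply_apply] at h
  have h2 := ENNReal.ofReal_tsum_of_nonneg (fun i => sq_nonneg _) h.summable
  rw [h.tsum_eq] at h2
  simpa [ENNReal.ofReal_pow] using h2.symm

theorem countable_setOf_inner_ne_zero {ι E : Type*} [NormedAddCommGroup E] [InnerProductSpace ℂ E]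
    (b : HilbertBasis ι ℂ E) (x : E) : {i | inner ℂ (b i) x ≠ 0}.Countable := by
  have h := lp.hasSum_norm (by norm_num : (0 : ℝ) < (2 : ℝ≥0∞).toReal) (b.repr x)
  simp only [ENNReal.toReal_ofNat, Real.rpow_ofNat, LinearIsometryEquiv.norm_map,
    HilbertBasis.repr_apply_apply] at h
  convert h.summable.countable_support using 1
  ext i
  simp

variable {H : Type*} [NormedAddCommGroup H] [InnerProductSpace ℂ H] [CompleteSpace H]

/-- Parseval's identity for the coefficients of an `H`-valued function with respect to a basis of the
scalar space `L²(m)`. The Hilbert space `H` need not be separable: a strongly measurable function is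
almost everywhere orthogonal to all but countably many vectors of a basis of `H`, and the scalar
identity holds for each of its components. -/
theorem tsum_enorm_integral_sq {X J : Type*} [MeasurableSpace X] {m : Measure X} [Countable J]
    (b : HilbertBasis J ℂ (Lp ℂ 2 m)) {g : X → H} (hg : MemLp g 2 m) :
    ∑' j, ‖∫ x, (starRingEnd ℂ) (b j x) • g x ∂m‖ₑ ^ 2 = ∫⁻ x, ‖g x‖ₑ ^ 2 ∂m := by
  obtain ⟨w, B, -⟩ := exists_hilbertBasis ℂ H
  obtain ⟨D, hDc, hD⟩ := hg.1.stronglyMeasurable_mk.isSeparable_range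
  -- the directions in which `g` has a nonzero component
  set I : Set w := ⋃ x ∈ D, {i | inner ℂ (B i) x ≠ 0} with hI
  have hIc : I.Countable := hDc.biUnion fun x _ => countable_setOf_inner_ne_zero B x
  have hIz : ∀ᵐ x ∂m, ∀ i ∉ I, inner ℂ (B i) (g x) = 0 := by
    filter_upwards [hg.1.ae_eq_mk] with x hx i hi
    rw [hx]
    have hcl : IsClosed {v : H | inner ℂ (B i) v = 0} :=
      isClosed_eq (by fun_prop) continuous_const
    refine closure_minimal (fun v hv => ?_) hcl (hD (mem_range_self x))
    by_contra hne
    exact hi (mem_biUnion hv hne)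
  have hgi : ∀ i, MemLp (fun x => inner ℂ (B i) (g x)) 2 m := fun i =>
    (innerSL ℂ (B i)).comp_memLp' hg
  have hint : ∀ j, Integrable (fun x => (starRingEnd ℂ) (b j x) • g x) m := fun j =>
    memLp_one_iff_integrable.1 (hg.smul (Lp.memLp (b j)).star)
  have hcoef : ∀ i j, inner ℂ (b j) (hgi i).toLp =
      inner ℂ (B i) (∫ x, (starRingEnd ℂ) (b j x) • g x ∂m) := by
    intro i j
    rw [L2.inner_def, ← integral_inner (hint j)]
    refine integral_congr_ae ?_
    filter_upwards [(hgi i).coeFn_toLp] with x hx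
    rw [hx, inner_smul_right, RCLike.inner_apply, mul_comm]
  have hnorm : ∀ i, ‖(hgi i).toLp‖ₑ ^ 2 = ∫⁻ x, ‖inner ℂ (B i) (g x)‖ₑ ^ 2 ∂m := by
    intro i
    rw [Lp.enorm_toLp, eLpNorm_eq_lintegral_rpow_enorm_toReal (by norm_num) (by norm_num)]
    simp only [ENNReal.toReal_ofNat, ENNReal.rpow_ofNat]
    rw [← ENNReal.rpow_natCast, ← ENNReal.rpow_mul]
    norm_num
  have hrestr : ∀ F : w → ℝ≥0∞, (∀ i ∉ I, F i = 0) → ∑' i : I, F i = ∑' i, F i := by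
    intro F hF
    exact tsum_subtype_eq_of_support_subset fun i hi => by
      by_contra h
      exact hi (hF i h)
  have := hIc.to_subtype
  calc ∑' j, ‖∫ x, (starRingEnd ℂ) (b j x) • g x ∂m‖ₑ ^ 2
      = ∑' j, ∑' i : I, ‖inner ℂ (b j) (hgi i).toLp‖ₑ ^ 2 := by
        refine tsum_congr fun j => ?_
        rw [hrestr (fun i => ‖inner ℂ (b j) (hgi i).toLp‖ₑ ^ 2), ← tsum_enorm_inner_sq B]
        · simp_rw [hcoef]
        · intro i hi
          have : (hgi i).toLp = 0 := by
            rw [← MemLp.toLp_zero MemLp.zero', MemLp.toLp_eq_toLp_iff]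
            exact hIz.mono fun x hx => hx i hi
          simp [this]
    _ = ∑' i : I, ∑' j, ‖inner ℂ (b j) (hgi i).toLp‖ₑ ^ 2 := ENNReal.tsum_comm
    _ = ∑' i : I, ∫⁻ x, ‖inner ℂ (B i) (g x)‖ₑ ^ 2 ∂m := by
        simp_rw [tsum_enorm_inner_sq, hnorm]
    _ = ∫⁻ x, ∑' i : I, ‖inner ℂ (B i) (g x)‖ₑ ^ 2 ∂m := by
        rw [lintegral_tsum]
        exact fun i => ((hgi i).1.enorm).pow_const 2
    _ = ∫⁻ x, ‖g x‖ₑ ^ 2 ∂m := by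
        refine lintegral_congr_ae ?_
        filter_upwards [hIz] with x hx
        rw [← tsum_enorm_inner_sq B (g x), hrestr (fun i => ‖inner ℂ (B i) (g x)‖ₑ ^ 2)]
        intro i hi
        simp [hx i hi]

end Parseval

/-! ### Superposition of a measurable family of maps with a measurable function -/

/-- A Carathéodory family of maps `Ψ x`, continuous in the vector and measurable in `x`, takes
strongly measurable functions to strongly measurable functions, without separability of `E`. -/
theorem stronglyMeasurable_apply_of_continuous {X E F : Type*} [MeasurableSpace X]
    [TopologicalSpace E] [TopologicalSpace F] [TopologicalSpace.PseudoMetrizableSpace F]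
    [AddCommMonoid F] [ContinuousAdd F] {Ψ : X → E → F}
    (hm : ∀ v, StronglyMeasurable fun x => Ψ x v) (hc : ∀ x, Continuous (Ψ x))
    {u : X → E} (hu : StronglyMeasurable u) : StronglyMeasurable fun x => Ψ x (u x) := by
  classical
  refine stronglyMeasurable_of_tendsto atTop (f := fun n x => Ψ x (hu.approx n x)) (fun n => ?_) ?_
  · have : (fun x => Ψ x (hu.approx n x)) = fun x => ∑ v ∈ (hu.approx n).range,
        (hu.approx n ⁻¹' {v}).indicator (fun x => Ψ x v) x := by
      funext x
      rw [Finset.sum_eq_single (hu.approx n x)]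
      · simp
      · intro v _ hv
        exact indicator_of_notMem (fun h => hv h.symm) _
      · intro h
        exact absurd (SimpleFunc.mem_range_self _ x) h
    rw [this]
    exact Finset.stronglyMeasurable_fun_sum _ fun v _ =>
      (hm v).indicator ((hu.approx n).measurableSet_fiber v)
  · rw [tendsto_pi_nhds]
    exact fun x => ((hc x).tendsto _).comp (hu.tendsto_approx x)

/-! ### Isometric maps into `L²` given by representatives -/

section Representatives

variable {H : Type*} [NormedAddCommGroup H] [InnerProductSpace ℂ H]

theorem eLpNorm_two_sq {X E : Type*} [MeasurableSpace X] [NormedAddCommGroup E] (μ : Measure X)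
    (g : X → E) : eLpNorm g 2 μ ^ 2 = ∫⁻ x, ‖g x‖ₑ ^ 2 ∂μ := by
  rw [eLpNorm_eq_lintegral_rpow_enorm_toReal (by norm_num) (by norm_num)]
  simp only [ENNReal.toReal_ofNat, ENNReal.rpow_ofNat]
  rw [← ENNReal.rpow_natCast, ← ENNReal.rpow_mul]
  norm_num

/-- A map that assigns to each vector a square integrable function of the same norm, and is linear up
to null sets, is a linear isometry into `L²(μ; H)`. -/
theorem exists_linearIsometry_of_lintegral {X : Type*} [MeasurableSpace X] {μ : Measure X}
    {Z : Type*} [NormedAddCommGroup Z] [NormedSpace ℂ Z] {B : Z → X → H}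
    (hm : ∀ ζ, AEStronglyMeasurable (B ζ) μ)
    (hn : ∀ ζ, ∫⁻ x, ‖B ζ x‖ₑ ^ 2 ∂μ = ‖ζ‖ₑ ^ 2)
    (hadd : ∀ ζ ξ, B (ζ + ξ) =ᵐ[μ] fun x => B ζ x + B ξ x)
    (hsmul : ∀ (c : ℂ) ζ, B (c • ζ) =ᵐ[μ] fun x => c • B ζ x) :
    ∃ A : Z →ₗᵢ[ℂ] Lp H 2 μ, ∀ ζ, B ζ =ᵐ[μ] A ζ := by
  have hnorm : ∀ ζ, eLpNorm (B ζ) 2 μ = ‖ζ‖ₑ := by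
    intro ζ
    exact (ENNReal.pow_right_strictMono two_ne_zero).injective ((eLpNorm_two_sq μ _).trans (hn ζ))
  have hL : ∀ ζ, MemLp (B ζ) 2 μ := fun ζ => ⟨hm ζ, by simp [hnorm]⟩
  refine ⟨⟨⟨⟨fun ζ => (hL ζ).toLp, fun ζ ξ => ?_⟩, fun c ζ => ?_⟩, fun ζ => ?_⟩, fun ζ => ?_⟩
  · rw [← MemLp.toLp_add, MemLp.toLp_eq_toLp_iff]
    exact hadd ζ ξ
  · rw [RingHom.id_apply, ← MemLp.toLp_const_smul, MemLp.toLp_eq_toLp_iff]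
    exact hsmul c ζ
  · change ‖(hL ζ).toLp‖ = _
    rw [Lp.norm_toLp, hnorm, toReal_enorm]
  · exact (hL ζ).coeFn_toLp.symm

end Representatives

/-! ### The scattering operator on the lattice -/

section Lattice

/-- The torus carries the product of the normalized Haar measures, as in Mathlib's theory of
multivariate Fourier series, where this instance is local as well. -/
local instance : MeasureSpace UnitAddCircle := ⟨AddCircle.haarAddCircle⟩

local instance : IsProbabilityMeasure (volume : Measure UnitAddCircle) :=
  inferInstanceAs (IsProbabilityMeasure AddCircle.haarAddCircle)

/-- The measurable parametrization of the momentum range by the torus `(ℝ/ℤ)^d`, up to the faces of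
the box: the coordinates of `t` are represented in `(-1/2, 1/2]` and scaled by `2πħ/ε`. -/
def torusMomentum (d : ℕ) (ħ ε : ℝ) (t : UnitAddTorus (Fin d)) : EuclideanSpace ℝ (Fin d) :=
  WithLp.toLp 2 ((2 * Real.pi * ħ / ε) •
    fun i => ((AddCircle.equivIoc (1 : ℝ) (-(1 / 2)) (t i) : ℝ)))

theorem measurable_torusMomentum (d : ℕ) (ħ ε : ℝ) : Measurable (torusMomentum d ħ ε) := by
  refine (PiLp.volume_preserving_toLp (Fin d)).measurable.comp ?_
  refine measurable_pi_lambda _ fun i => Measurable.const_mul ?_ (2 * Real.pi * ħ / ε)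
  exact measurable_subtype_coe.comp
    ((AddCircle.measurableEquivIoc 1 (-(1 / 2))).measurable.comp (measurable_pi_apply i))

open scoped Pointwise in
theorem setIntegral_momentumBox {F : Type*} [NormedAddCommGroup F] [NormedSpace ℝ F] {d : ℕ}
    {ħ ε : ℝ} (hħ : 0 < ħ) (hε : 0 < ε) (g : EuclideanSpace ℝ (Fin d) → F) :
    ∫ p in momentumBox d ħ ε, g p =
      (2 * Real.pi * ħ / ε) ^ d • ∫ t : UnitAddTorus (Fin d), g (torusMomentum d ħ ε t) := by
  set L : ℝ := 2 * Real.pi * ħ / ε with hL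
  have hL0 : 0 < L := by positivity
  have hL2 : Real.pi * ħ / ε = L / 2 := by rw [hL]; ring
  rw [UnitAddTorus.integral_preimage _ (fun _ => -(1 / 2))]
  set s : Set (Fin d → ℝ) := {x | ∀ i, x i ∈ Ioc (-(1 / 2) : ℝ) (-(1 / 2) + 1)} with hs
  have hsm : MeasurableSet s := MeasurableSet.univ_pi' fun i => measurableSet_Ioc
  have h1 : ∫ x in s, g (torusMomentum d ħ ε fun i => (x i : UnitAddCircle)) =
      ∫ x in s, (fun x => g (WithLp.toLp 2 x)) (L • x) := by
    refine setIntegral_congr_fun hsm fun x hx => ?_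
    simp only [torusMomentum]
    congr 3
    funext i
    exact AddCircle.equivIoc_coe_of_mem (hx i)
  rw [h1, Measure.setIntegral_comp_smul_of_pos volume (fun x => g (WithLp.toLp 2 x)) s hL0, smul_smul,
    Module.finrank_fin_fun, mul_inv_cancel₀ (by positivity), one_smul]
  have h2 : L • s = Set.pi univ fun _ : Fin d => Ioc (-(L / 2)) (L / 2) := by
    ext x
    rw [Set.mem_smul_set_iff_inv_smul_mem₀ hL0.ne']
    simp only [hs, mem_ofPred_eq, Pi.smul_apply, smul_eq_mul, Set.mem_pi, mem_univ, true_imp_iff]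
    simp only [mem_Ioc]
    refine forall_congr' fun i => and_congr ?_ ?_
    · rw [lt_inv_mul_iff₀ hL0]
      constructor <;> intro h <;> linarith
    · rw [inv_mul_le_iff₀ hL0]
      constructor <;> intro h <;> linarith
  have h3 : WithLp.toLp 2 ⁻¹' (momentumBox d ħ ε) =
      Set.pi univ fun _ : Fin d => Ico (-(L / 2)) (L / 2) := by
    ext x
    simp [momentumBox, hL2]
  rw [h2, ← (PiLp.volume_preserving_toLp (Fin d)).setIntegral_preimage_emb
    (MeasurableEquiv.toLp 2 (Fin d → ℝ)).measurableEmbedding, h3]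
  refine setIntegral_congr_set ?_
  exact Measure.univ_pi_Ico_ae_eq_Icc.trans Measure.univ_pi_Ioc_ae_eq_Icc.symm

variable {H : Type*} [NormedAddCommGroup H] [InnerProductSpace ℂ H]

theorem exp_inner_latticePoint {d : ℕ} {ħ ε : ℝ} (hħ : 0 < ħ) (hε : 0 < ε) (j : Fin d → ℤ)
    (t : UnitAddTorus (Fin d)) :
    Complex.exp (Complex.I *
      ((inner ℝ (latticePoint ε j) (torusMomentum d ħ ε t) / ħ : ℝ) : ℂ)) =
      UnitAddTorus.mFourier j t := by
  have ht : ∀ i, t i = ((AddCircle.equivIoc (1 : ℝ) (-(1 / 2)) (t i) : ℝ) : UnitAddCircle) :=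
    fun i => ((AddCircle.equivIoc (1 : ℝ) (-(1 / 2))).symm_apply_apply (t i)).symm
  have hF : UnitAddTorus.mFourier j t = ∏ i, Complex.exp (2 * Real.pi * Complex.I * (j i) *
      ((AddCircle.equivIoc (1 : ℝ) (-(1 / 2)) (t i) : ℝ) : ℂ)) := by
    simp only [UnitAddTorus.mFourier, ContinuousMap.coe_mk]
    refine Finset.prod_congr rfl fun i _ => ?_
    conv_lhs => rw [ht i]
    rw [fourier_coe_apply]
    simp
  rw [hF, ← Complex.exp_sum]
  congr 1
  simp only [latticePoint, torusMomentum, PiLp.inner_apply, Pi.smul_apply, smul_eq_mul,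
    RCLike.inner_apply, conj_trivial, Finset.sum_div, Complex.ofReal_sum, Finset.mul_sum]
  refine Finset.sum_congr rfl fun i _ => ?_
  push_cast
  have h1 : (ħ : ℂ) ≠ 0 := by exact_mod_cast hħ.ne'
  have h2 : (ε : ℂ) ≠ 0 := by exact_mod_cast hε.ne'
  field_simp

/-- The matrix elements of the scattering operator on the lattice are Fourier coefficients on the
torus. -/
theorem smul_latticeKernel {d : ℕ} {ħ ε : ℝ} (hħ : 0 < ħ) (hε : 0 < ε)
    (W : EuclideanSpace ℝ (Fin d) → (H ≃ₗᵢ[ℂ] H)) (j : Fin d → ℤ) (ζ : H) :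
    ε ^ d • latticeKernel ħ ε W (latticePoint ε j) ζ =
      ∫ t : UnitAddTorus (Fin d),
        UnitAddTorus.mFourier j t • W (torusMomentum d ħ ε t) ζ := by
  rw [latticeKernel, setIntegral_momentumBox hħ hε, smul_smul, smul_smul]
  have : ε ^ d * (((2 * Real.pi * ħ) ^ d)⁻¹ * (2 * Real.pi * ħ / ε) ^ d) = 1 := by
    rw [div_pow]
    have := hħ.ne'
    field_simp
  rw [← mul_assoc] at this
  rw [this, one_smul]
  simp_rw [exp_inner_latticePoint hħ hε]

variable [CompleteSpace H]

theorem norm_mFourier_apply {d : ℕ} (j : Fin d → ℤ) (t : UnitAddTorus (Fin d)) :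
    ‖UnitAddTorus.mFourier j t‖ = 1 := by
  simp only [UnitAddTorus.mFourier, fourier_apply, ContinuousMap.coe_mk, norm_prod]
  exact Finset.prod_eq_one fun i _ => Circle.norm_coe _

/-- The coefficients of the product of the Fourier series `∑ a k e_k` with a bounded `H`-valued
function `w` are given by a convolution series, which converges unconditionally in `H` because the
coefficient of `F • w` depends continuously on `F` in `L²`. -/
theorem hasSum_smul_integral_mFourier {d : ℕ} (a : lp (fun _ : Fin d → ℤ => ℂ) 2)
    {w : UnitAddTorus (Fin d) → H} (hw : StronglyMeasurable w) {C : ℝ} (hC : ∀ t, ‖w t‖ = C)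
    (j : Fin d → ℤ) :
    HasSum (fun k => a k • ∫ t, UnitAddTorus.mFourier (j + k) t • w t)
      (∫ t, UnitAddTorus.mFourier j t •
        ((UnitAddTorus.mFourierBasis (d := Fin d)).repr.symm a t • w t)) := by
  have hw2 : MemLp (fun t => UnitAddTorus.mFourier j t • w t) 2 volume := by
    refine MemLp.of_bound (C := C)
      ((UnitAddTorus.mFourier j).continuous.stronglyMeasurable.smul hw).aestronglyMeasurable ?_
    refine Eventually.of_forall fun t => ?_
    rw [norm_smul, norm_mFourier_apply, one_mul, hC]
  set b := UnitAddTorus.mFourierBasis (d := Fin d) with hb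
  have hT := (b.hasSum_repr (b.repr.symm a)).mapL
    (((ContinuousLinearMap.lsmul ℂ ℂ (E := H)).lpPairing volume 2 2).flip hw2.toLp)
  simp only [ContinuousLinearMap.flip_apply, map_smul, LinearIsometryEquiv.apply_symm_apply] at hT
  have hval : ∀ F : Lp ℂ 2 (volume : Measure (UnitAddTorus (Fin d))),
      (ContinuousLinearMap.lsmul ℂ ℂ (E := H)).lpPairing volume 2 2 F hw2.toLp =
        ∫ t, UnitAddTorus.mFourier j t • (F t • w t) := by
    intro F
    rw [ContinuousLinearMap.lpPairing_eq_integral]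
    refine integral_congr_ae ?_
    filter_upwards [hw2.coeFn_toLp] with t ht
    rw [ContinuousLinearMap.lsmul_apply, ht, smul_comm]
  simp only [hval] at hT
  convert hT using 3 with k
  refine integral_congr_ae ?_
  have := UnitAddTorus.coeFn_mFourierLp (d := Fin d) 2 k
  rw [← UnitAddTorus.coe_mFourierBasis] at this
  filter_upwards [this] with t ht
  rw [ht, UnitAddTorus.mFourier_add, mul_smul]

theorem tsum_enorm_integral_mFourier_sq {d : ℕ} {g : UnitAddTorus (Fin d) → H}
    (hg : MemLp g 2 volume) :
    ∑' j : Fin d → ℤ, ‖∫ t, UnitAddTorus.mFourier j t • g t‖ₑ ^ 2 = ∫⁻ t, ‖g t‖ₑ ^ 2 := by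
  rw [← tsum_enorm_integral_sq (UnitAddTorus.mFourierBasis (d := Fin d)) hg,
    ← (Equiv.neg (Fin d → ℤ)).tsum_eq]
  refine tsum_congr fun j => ?_
  congr 2
  refine integral_congr_ae ?_
  have := UnitAddTorus.coeFn_mFourierLp (d := Fin d) 2 j
  rw [← UnitAddTorus.coe_mFourierBasis] at this
  filter_upwards [this] with t ht
  rw [ht, Equiv.neg_apply, UnitAddTorus.mFourier_neg]


theorem ae_lattice_iff {d : ℕ} {ε : ℝ} (hε : 0 < ε) {p : EuclideanSpace ℝ (Fin d) → Prop} :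
    (∀ᵐ y ∂(PointerScale.lattice ε hε).measure d, p y) ↔ ∀ k, p (latticePoint ε k) := by
  have h0 : ENNReal.ofReal (ε ^ d) ≠ 0 := by
    rw [Ne, ENNReal.ofReal_eq_zero, not_le]
    positivity
  rw [PointerScale.measure, Measure.ae_sum_iff]
  refine forall_congr' fun k => ?_
  rw [Measure.ae_ennreal_smul_measure_iff h0, ae_dirac_eq, eventually_pure]

theorem lintegral_lattice {d : ℕ} {ε : ℝ} (hε : 0 < ε) (F : EuclideanSpace ℝ (Fin d) → ℝ≥0∞) :
    ∫⁻ y, F y ∂(PointerScale.lattice ε hε).measure d =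
      ENNReal.ofReal (ε ^ d) * ∑' k, F (latticePoint ε k) := by
  rw [PointerScale.measure, lintegral_sum_measure, ← ENNReal.tsum_mul_left]
  simp

theorem exists_linearIsometry_scatter_lattice {d : ℕ} {ħ ε : ℝ} (hħ : 0 < ħ) (hε : 0 < ε)
    {W : EuclideanSpace ℝ (Fin d) → (H ≃ₗᵢ[ℂ] H)} (hW : ∀ ζ, StronglyMeasurable fun p => W p ζ)
    (f : PointerState d (.lattice ε hε)) :
    ∃ A : H →ₗᵢ[ℂ] Lp H 2 ((PointerScale.lattice ε hε).measure d), ∀ ζ,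
      scatter ħ (.lattice ε hε) W (fun z => f.f₀ z • ζ)
        =ᵐ[(PointerScale.lattice ε hε).measure d] A ζ := by
  set μ := (PointerScale.lattice ε hε).measure d with hμ
  have h0 : ENNReal.ofReal (ε ^ d) ≠ 0 := by
    rw [Ne, ENNReal.ofReal_eq_zero, not_le]
    positivity
  have hsum : ENNReal.ofReal (ε ^ d) * ∑' k, ‖f.f₀ (latticePoint ε (-k))‖ₑ ^ 2 = 1 := by
    rw [← f.norm_sq, lintegral_lattice, ← (Equiv.neg (Fin d → ℤ)).tsum_eq
      fun k => ‖f.f₀ (latticePoint ε k)‖ₑ ^ 2]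
    rfl
  have hfin : ∑' k, ‖f.f₀ (latticePoint ε (-k))‖ₑ ^ 2 ≠ ∞ := by
    intro h
    rw [h, ENNReal.mul_top h0] at hsum
    exact ENNReal.top_ne_one hsum
  have hmem : Memℓp (fun k : Fin d → ℤ => f.f₀ (latticePoint ε (-k))) 2 := by
    refine memℓp_gen ?_
    have := ENNReal.summable_toReal hfin
    simpa using this
  -- the sign in `-k` turns the convolution over `j - k` into the sum over `j + k` of the product
  let a : lp (fun _ : Fin d → ℤ => ℂ) 2 := ⟨_, hmem⟩
  let w : H → UnitAddTorus (Fin d) → H := fun ζ t => W (torusMomentum d ħ ε t) ζ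
  have hw : ∀ ζ, StronglyMeasurable (w ζ) := fun ζ =>
    (hW ζ).comp_measurable (measurable_torusMomentum d ħ ε)
  set F : Lp ℂ 2 (volume : Measure (UnitAddTorus (Fin d))) :=
    (UnitAddTorus.mFourierBasis (d := Fin d)).repr.symm a with hF
  have hS : ∀ ζ j, HasSum
      (fun k => ε ^ d • latticeKernel ħ ε W (latticePoint ε j - latticePoint ε k)
        (f.f₀ (latticePoint ε k) • ζ))
      (∫ t, UnitAddTorus.mFourier j t • (F t • w ζ t)) := by
    intro ζ j
    have := hasSum_smul_integral_mFourier a (hw ζ) (C := ‖ζ‖) (fun t => by simp [w]) j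
    rw [← (Equiv.neg (Fin d → ℤ)).hasSum_iff] at this
    convert this using 2 with k
    have hsub : latticePoint ε j - latticePoint ε k = latticePoint (d := d) ε (j - k) := by
      ext i
      simp [latticePoint]
      ring
    rw [hsub, smul_latticeKernel hħ hε]
    simp only [map_smul, Function.comp_apply, Equiv.neg_apply, ← sub_eq_add_neg]
    simp_rw [smul_comm _ (f.f₀ (latticePoint ε k))]
    rw [integral_smul]
    simp [a, w]
  have hval : ∀ ζ j, scatter ħ (.lattice ε hε) W (fun z => f.f₀ z • ζ) (latticePoint ε j) =
      ∫ t, UnitAddTorus.mFourier j t • (F t • w ζ t) := fun ζ j => (hS ζ j).tsum_eq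
  have hFn : ∫⁻ t, ‖F t‖ₑ ^ 2 = ∑' k, ‖f.f₀ (latticePoint ε (-k))‖ₑ ^ 2 := by
    have h1 := tsum_enorm_inner_sq (UnitAddTorus.mFourierBasis (d := Fin d)) F
    simp_rw [← HilbertBasis.repr_apply_apply] at h1
    rw [hF, LinearIsometryEquiv.apply_symm_apply, ← hF, Lp.enorm_def, eLpNorm_two_sq] at h1
    exact h1.symm
  have hFw : ∀ ζ, MemLp (fun t => F t • w ζ t) 2 volume := by
    intro ζ
    refine (Lp.memLp F).of_le_mul (c := ‖ζ‖)
      ((Lp.aestronglyMeasurable F).smul (hw ζ).aestronglyMeasurable) ?_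
    refine Eventually.of_forall fun t => ?_
    simp [norm_smul, w, mul_comm]
  have hI : ∀ ζ j, Integrable (fun t => UnitAddTorus.mFourier j t • (F t • w ζ t)) volume := by
    intro ζ j
    refine ((hFw ζ).integrable one_le_two).mono
      ((UnitAddTorus.mFourier j).continuous.aestronglyMeasurable.smul (hFw ζ).1) ?_
    exact Eventually.of_forall fun t => by rw [norm_smul, norm_mFourier_apply, one_mul]
  refine exists_linearIsometry_of_lintegral (fun ζ => ?_) (fun ζ => ?_) (fun ζ ξ => ?_)
    (fun c ζ => ?_)
  · rw [hμ, PointerScale.measure, aestronglyMeasurable_sum_measure_iff]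
    exact fun k => (aestronglyMeasurable_dirac).smul_measure _
  · rw [hμ, lintegral_lattice]
    simp_rw [hval]
    rw [tsum_enorm_integral_mFourier_sq (hFw ζ)]
    have : ∀ t, ‖F t • w ζ t‖ₑ ^ 2 = ‖F t‖ₑ ^ 2 * ‖ζ‖ₑ ^ 2 := by
      intro t
      simp [enorm_smul, w, mul_pow]
    simp_rw [this]
    rw [lintegral_mul_const _ (by fun_prop), hFn, ← mul_assoc, hsum, one_mul]
  · refine (ae_lattice_iff hε).2 fun j => ?_
    simp only [hval]
    rw [← integral_add (hI ζ j) (hI ξ j)]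
    simp only [w, map_add, smul_add]
  · refine (ae_lattice_iff hε).2 fun j => ?_
    simp only [hval]
    rw [← integral_smul]
    simp only [w, map_smul, smul_comm c]

end Lattice

/-! ### The scattering operator on the continuum -/

section Continuum

variable {H : Type*} [NormedAddCommGroup H] [InnerProductSpace ℂ H]

theorem toL2_eq_of_ae_eq {H : Type*} [NormedAddCommGroup H] {X : Type*} [MeasurableSpace X]
    {μ : Measure X} {ψ : X → H} {g : Lp H 2 μ} (h : ψ =ᵐ[μ] g) : toL2 μ ψ = g := by
  have hm : MemLp ψ 2 μ := (memLp_congr_ae h).2 (Lp.memLp g)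
  rw [toL2, dif_pos hm]
  exact Lp.ext (hm.coeFn_toLp.trans h)

theorem exists_linearIsometry_smul {X : Type*} [MeasurableSpace X] {μ : Measure X} {f : X → ℂ}
    (hf : AEStronglyMeasurable f μ) (h1 : ∫⁻ x, ‖f x‖ₑ ^ 2 ∂μ = 1) :
    ∃ A : H →ₗᵢ[ℂ] Lp H 2 μ, ∀ ζ, (fun x => f x • ζ) =ᵐ[μ] A ζ := by
  refine exists_linearIsometry_of_lintegral (fun ζ => hf.smul_const ζ) (fun ζ => ?_)
    (fun ζ ξ => ?_) (fun c ζ => ?_)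
  · simp_rw [enorm_smul, mul_pow]
    rw [lintegral_mul_const'' _ (hf.enorm.pow_const 2), h1, one_mul]
  · exact Eventually.of_forall fun x => smul_add _ _ _
  · exact Eventually.of_forall fun x => smul_comm _ _ _

/-- Multiplication by a strongly measurable family of unitary operators is isometric on `L²`. -/
theorem exists_linearIsometry_apply {X : Type*} [MeasurableSpace X] {μ : Measure X}
    {V : X → (H ≃ₗᵢ[ℂ] H)} (hV : ∀ ζ, StronglyMeasurable fun x => V x ζ) :
    ∃ M : Lp H 2 μ →ₗᵢ[ℂ] Lp H 2 μ, ∀ ψ, (fun x => V x (ψ x)) =ᵐ[μ] M ψ := by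
  refine exists_linearIsometry_of_lintegral (fun ψ => ?_) (fun ψ => ?_)
    (fun ψ φ => ?_) (fun c ψ => ?_)
  · exact (stronglyMeasurable_apply_of_continuous hV (fun x => (V x).continuous)
      (Lp.stronglyMeasurable ψ)).aestronglyMeasurable
  · simp only [LinearIsometryEquiv.enorm_map]
    rw [← eLpNorm_two_sq, Lp.enorm_def]
  · filter_upwards [Lp.coeFn_add ψ φ] with x hx
    rw [hx, Pi.add_apply, map_add]
  · filter_upwards [Lp.coeFn_smul c ψ] with x hx
    rw [hx, Pi.smul_apply, map_smul]

variable [CompleteSpace H]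

theorem exists_linearIsometry_scatter_continuum {d : ℕ} (ħ : ℝ)
    {W : EuclideanSpace ℝ (Fin d) → (H ≃ₗᵢ[ℂ] H)} (hW : ∀ ζ, StronglyMeasurable fun p => W p ζ)
    (f : PointerState d .continuum) :
    ∃ A : H →ₗᵢ[ℂ] Lp H 2 (PointerScale.continuum.measure d), ∀ ζ,
      scatter ħ .continuum W (fun z => f.f₀ z • ζ) =ᵐ[PointerScale.continuum.measure d] A ζ := by
  obtain ⟨E, hE⟩ := exists_linearIsometry_smul (H := H) f.aestronglyMeasurable f.norm_sq
  obtain ⟨M, hM⟩ := exists_linearIsometry_apply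
    (μ := (volume : Measure (EuclideanSpace ℝ (Fin d))))
    (V := fun ξ => W ((2 * Real.pi * ħ) • ξ))
    (fun ζ => (hW ζ).comp_measurable (measurable_const_smul _))
  let Φ := Lp.fourierTransformₗᵢ (EuclideanSpace ℝ (Fin d)) H
  refine ⟨Φ.symm.toLinearIsometry.comp (M.comp (Φ.toLinearIsometry.comp E)), fun ζ => ?_⟩
  refine Eventually.of_forall fun y => ?_
  have h1 : toL2 volume (fun z => f.f₀ z • ζ) = E ζ := toL2_eq_of_ae_eq (hE ζ)
  simp only [scatter]
  rw [h1, toL2_eq_of_ae_eq (hM _)]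
  rfl

/-- The map `ζ ↦ S (ζ ⊗ f₀)` is an isometry from `H` to `L²(Λ; H)`, on both pointer scales. -/
theorem exists_linearIsometry_scatter {d : ℕ} {ħ : ℝ} (hħ : 0 < ħ) {Λ : PointerScale}
    {W : EuclideanSpace ℝ (Fin d) → (H ≃ₗᵢ[ℂ] H)} (hW : ∀ ζ, StronglyMeasurable fun p => W p ζ)
    (f : PointerState d Λ) :
    ∃ A : H →ₗᵢ[ℂ] Lp H 2 (Λ.measure d), ∀ ζ,
      scatter ħ Λ W (fun z => f.f₀ z • ζ) =ᵐ[Λ.measure d] A ζ := by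
  cases Λ with
  | continuum => exact exists_linearIsometry_scatter_continuum ħ hW f
  | lattice ε hε => exact exists_linearIsometry_scatter_lattice hħ hε hW f

end Continuum

/-! ### Point values -/

section PointValue

theorem finite_setOf_latticePoint_mem_closedBall {d : ℕ} {ε : ℝ} (hε : 0 < ε)
    (x : EuclideanSpace ℝ (Fin d)) (r : ℝ) :
    {k : Fin d → ℤ | latticePoint ε k ∈ Metric.closedBall x r}.Finite := by
  refine (Set.Finite.pi' fun i : Fin d =>
    Set.finite_Icc ⌈(x i - r) / ε⌉ ⌊(x i + r) / ε⌋).subset fun k hk i => ?_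
  have h1 : |ε * (k i : ℝ) - x i| ≤ r := by
    refine le_trans ?_ (mem_closedBall_iff_norm.1 hk)
    simpa [latticePoint] using PiLp.norm_apply_le (latticePoint ε k - x) i
  rw [abs_le] at h1
  constructor
  · rw [Int.ceil_le, div_le_iff₀ hε]
    linarith
  · rw [Int.le_floor, le_div_iff₀ hε]
    linarith

instance isLocallyFiniteMeasure_measure {d : ℕ} (Λ : PointerScale) :
    IsLocallyFiniteMeasure (Λ.measure d) := by
  cases Λ with
  | continuum => exact inferInstanceAs (IsLocallyFiniteMeasure volume)
  | lattice ε hε =>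
    refine ⟨fun x => ⟨Metric.closedBall x 1, Metric.closedBall_mem_nhds x one_pos, ?_⟩⟩
    have hfin := finite_setOf_latticePoint_mem_closedBall hε x 1
    rw [← lintegral_indicator_one Metric.isClosed_closedBall.measurableSet, lintegral_lattice]
    refine ENNReal.mul_lt_top ENNReal.ofReal_lt_top ?_
    rw [tsum_eq_sum (s := hfin.toFinset)]
    · refine ENNReal.sum_lt_top.2 fun k _ => ?_
      exact (indicator_le_self _ _ _).trans_lt ENNReal.one_lt_top
    · intro k hk
      rw [Set.Finite.mem_toFinset] at hk
      exact indicator_of_notMem (s := Metric.closedBall x 1) hk (1 : EuclideanSpace ℝ (Fin d) → ℝ≥0∞)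

variable {H : Type*} [NormedAddCommGroup H] [InnerProductSpace ℂ H] {d : ℕ}

theorem setAverage_congr_of_ae_eq {X : Type*} [MeasurableSpace X] {μ : Measure X} {ψ φ : X → H}
    (h : ψ =ᵐ[μ] φ) (s : Set X) : ⨍ z in s, ψ z ∂μ = ⨍ z in s, φ z ∂μ :=
  average_congr (ae_restrict_of_ae h)

theorem hasPointValue_congr {Λ : PointerScale} {ψ φ : EuclideanSpace ℝ (Fin d) → H}
    (h : ψ =ᵐ[Λ.measure d] φ) (y : EuclideanSpace ℝ (Fin d)) (v : H) :
    HasPointValue Λ ψ y v ↔ HasPointValue Λ φ y v := by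
  simp only [HasPointValue, setAverage_congr_of_ae_eq h]

theorem HasPointValue.pointValue_eq {Λ : PointerScale} {ψ : EuclideanSpace ℝ (Fin d) → H}
    {y : EuclideanSpace ℝ (Fin d)} {v : H} (h : HasPointValue Λ ψ y v) :
    pointValue Λ ψ y = v := by
  have hex : ∃ v, HasPointValue Λ ψ y v := ⟨v, h⟩
  rw [pointValue, dif_pos hex]
  exact tendsto_nhds_unique hex.choose_spec h

/-- Lebesgue's differentiation theorem for both pointer measures. -/
theorem ae_hasPointValue [CompleteSpace H] {Λ : PointerScale} (g : Lp H 2 (Λ.measure d)) :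
    ∀ᵐ y ∂Λ.measure d, HasPointValue Λ g y (g y) := by
  have hg : LocallyIntegrable g (Λ.measure d) := (Lp.memLp g).locallyIntegrable one_le_two
  filter_upwards [(Besicovitch.vitaliFamily (Λ.measure d)).ae_tendsto_average hg] with y hy
  exact hy.comp (Besicovitch.tendsto_filterAt _ y)

theorem continuousWithinAt_integral_closedBall {E : Type*} [NormedAddCommGroup E]
    [NormedSpace ℝ E] {Λ : PointerScale} {g : EuclideanSpace ℝ (Fin d) → E}
    (hg : LocallyIntegrable g (Λ.measure d)) (y : EuclideanSpace ℝ (Fin d)) (r : ℝ) :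
    ContinuousWithinAt (fun r => ∫ z in Metric.closedBall y r, g z ∂(Λ.measure d)) (Ioi r) r := by
  simp_rw [← integral_indicator Metric.isClosed_closedBall.measurableSet]
  have hint : IntegrableOn g (Metric.closedBall y (r + 1)) (Λ.measure d) :=
    hg.integrableOn_isCompact (isCompact_closedBall y (r + 1))
  refine tendsto_integral_filter_of_dominated_convergence
    ((Metric.closedBall y (r + 1)).indicator fun z => ‖g z‖) ?_ ?_ ?_ ?_
  · exact Eventually.of_forall fun s =>
      hg.aestronglyMeasurable.indicator Metric.isClosed_closedBall.measurableSet
  · filter_upwards [nhdsWithin_le_nhds (Iio_mem_nhds (lt_add_one r))] with s hs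
    refine Eventually.of_forall fun z => ?_
    rw [norm_indicator_eq_indicator_norm]
    exact indicator_le_indicator_of_subset (Metric.closedBall_subset_closedBall (le_of_lt hs))
      (fun _ => norm_nonneg _) z
  · exact (integrable_indicator_iff Metric.isClosed_closedBall.measurableSet).2 hint.norm
  · refine Eventually.of_forall fun z => ?_
    refine tendsto_const_nhds.congr' ?_
    by_cases hz : z ∈ Metric.closedBall y r
    · filter_upwards [self_mem_nhdsWithin] with s hs
      rw [indicator_of_mem hz,
        indicator_of_mem (Metric.closedBall_subset_closedBall (le_of_lt hs) hz)]
    · have hz' : r < dist z y := not_le.1 hz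
      filter_upwards [nhdsWithin_le_nhds (Iio_mem_nhds hz')] with s hs
      have hzs : z ∉ Metric.closedBall y s := not_le.2 (mem_Iio.1 hs)
      rw [indicator_of_notMem hz, indicator_of_notMem hzs]

/-- Averages over closed balls are continuous from the right in the radius. The point `y` has to lie
in the support, since an average over a null set has the junk value `0`. -/
theorem continuousWithinAt_average_closedBall {Λ : PointerScale}
    {g : EuclideanSpace ℝ (Fin d) → H} (hg : LocallyIntegrable g (Λ.measure d))
    {y : EuclideanSpace ℝ (Fin d)} (hy : y ∈ (Λ.measure d).support) {r : ℝ} (hr : 0 < r) :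
    ContinuousWithinAt (fun r => ⨍ z in Metric.closedBall y r, g z ∂(Λ.measure d)) (Ioi r) r := by
  have h1 : ContinuousWithinAt (fun r => (Λ.measure d).real (Metric.closedBall y r)) (Ioi r) r := by
    simpa using continuousWithinAt_integral_closedBall (Λ := Λ) (d := d) (g := fun _ => (1 : ℝ))
      (locallyIntegrable_const 1) y r
  simp only [setAverage_eq]
  refine (h1.inv₀ ?_).smul (continuousWithinAt_integral_closedBall hg y r)
  have h2 : 0 < (Λ.measure d) (Metric.closedBall y r) :=
    (Measure.mem_support_iff_forall _).1 hy _ (Metric.closedBall_mem_nhds y hr)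
  exact (ENNReal.toReal_pos h2.ne' (isCompact_closedBall y r).measure_lt_top.ne).ne'

theorem stronglyMeasurable_average_closedBall {Λ : PointerScale}
    {g : EuclideanSpace ℝ (Fin d) → H} (hg : StronglyMeasurable g) (r : ℝ) :
    StronglyMeasurable fun y => ⨍ z in Metric.closedBall y r, g z ∂(Λ.measure d) := by
  have hs : MeasurableSet {p : EuclideanSpace ℝ (Fin d) × EuclideanSpace ℝ (Fin d) |
      dist p.2 p.1 ≤ r} :=
    measurableSet_le (measurable_snd.dist measurable_fst) measurable_const
  simp only [setAverage_eq]
  have h1 : StronglyMeasurable fun y => ((Λ.measure d).real (Metric.closedBall y r))⁻¹ :=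
    ((measurable_measure_prodMk_left (ν := Λ.measure d) hs).ennreal_toReal.inv).stronglyMeasurable
  refine h1.smul ?_
  simp_rw [← integral_indicator Metric.isClosed_closedBall.measurableSet]
  exact StronglyMeasurable.integral_prod_right'
    (f := {p : EuclideanSpace ℝ (Fin d) × EuclideanSpace ℝ (Fin d) |
      dist p.2 p.1 ≤ r}.indicator fun p => g p.2)
    ((hg.comp_measurable measurable_snd).indicator hs)

theorem continuous_average_closedBall [CompleteSpace H] {Λ : PointerScale}
    (y : EuclideanSpace ℝ (Fin d)) (r : ℝ) :
    Continuous fun g : Lp H 2 (Λ.measure d) =>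
      ⨍ z in Metric.closedBall y r, g z ∂(Λ.measure d) := by
  have hm : MeasurableSet (Metric.closedBall y r) := Metric.isClosed_closedBall.measurableSet
  have hf : Λ.measure d (Metric.closedBall y r) ≠ ∞ := (isCompact_closedBall y r).measure_lt_top.ne
  simp only [setAverage_eq]
  refine Continuous.const_smul ?_ _
  have h : ∀ g : Lp H 2 (Λ.measure d), (ContinuousLinearMap.lsmul ℂ ℂ (E := H)).lpPairing
      (Λ.measure d) 2 2 (indicatorConstLp 2 hm hf (1 : ℂ)) g =
        ∫ z in Metric.closedBall y r, g z ∂(Λ.measure d) := by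
    intro g
    rw [ContinuousLinearMap.lpPairing_eq_integral, ← integral_indicator hm]
    refine integral_congr_ae ?_
    filter_upwards [indicatorConstLp_coeFn (p := 2) (hs := hm) (hμs := hf) (c := (1 : ℂ))] with z hz
    rw [hz, ContinuousLinearMap.lsmul_apply]
    by_cases h : z ∈ Metric.closedBall y r <;> simp [h]
  simp_rw [← h]
  exact ContinuousLinearMap.continuous _

/-- A limit from the right at `0` may be computed along rational radii, for a function that is
continuous from the right. -/
theorem tendsto_nhdsGT_of_tendsto_rat {E : Type*} [PseudoMetricSpace E] {φ : ℝ → E} {v : E}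
    (hφ : ∀ r, 0 < r → ContinuousWithinAt φ (Ioi r) r)
    (h : Tendsto (fun q : ℚ => φ q) (comap (Rat.cast : ℚ → ℝ) (𝓝[>] 0)) (𝓝 v)) :
    Tendsto φ (𝓝[>] 0) (𝓝 v) := by
  rw [Metric.nhds_basis_closedBall.tendsto_right_iff] at h ⊢
  intro e he
  have h1 := h e he
  rw [eventually_comap, (nhdsGT_basis (0 : ℝ)).eventually_iff] at h1
  obtain ⟨δ, hδ, h1⟩ := h1
  filter_upwards [Ioo_mem_nhdsGT hδ] with r hr
  by_contra hne
  have h2 : ∀ᶠ s in 𝓝[>] r, φ s ∉ Metric.closedBall v e :=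
    (hφ r hr.1).eventually (Metric.isClosed_closedBall.isOpen_compl.mem_nhds hne)
  obtain ⟨u, hu, h2⟩ := ((nhdsGT_basis r).eventually_iff).1 h2
  obtain ⟨q, hq1, hq2⟩ := exists_rat_btwn (lt_min hu hr.2)
  exact h2 ⟨hq1, hq2.trans_le (min_le_left _ _)⟩
    (h1 ⟨hr.1.trans hq1, hq2.trans_le (min_le_right _ _)⟩ q rfl)

theorem neBot_comap_ratCast_nhdsGT : (comap (Rat.cast : ℚ → ℝ) (𝓝[>] 0)).NeBot := by
  rw [comap_neBot_iff]
  intro t ht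
  obtain ⟨u, hu, hut⟩ := (nhdsGT_basis (0 : ℝ)).mem_iff.1 ht
  obtain ⟨q, hq1, hq2⟩ := exists_rat_btwn hu
  exact ⟨q, hut ⟨hq1, hq2⟩⟩

variable [CompleteSpace H]

/-- The point values of a family `A (u ω)` of square integrable functions exist for almost all pairs
`(ω, y)` and depend measurably on them. -/
theorem ae_prod_hasPointValue {Λ : PointerScale} (A : H →ₗᵢ[ℂ] Lp H 2 (Λ.measure d))
    {Ω : Type*} [MeasurableSpace Ω] {ρ : Measure Ω} [SFinite ρ] {u : Ω → H}
    (hu : StronglyMeasurable u) :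
    (∀ᵐ x ∂ρ.prod (Λ.measure d), ∃ v, HasPointValue Λ (A (u x.1)) x.2 v) ∧
    AEStronglyMeasurable (fun x : Ω × EuclideanSpace ℝ (Fin d) => pointValue Λ (A (u x.1)) x.2)
      (ρ.prod (Λ.measure d)) := by
  let F : ℝ → Ω × EuclideanSpace ℝ (Fin d) → H := fun r x =>
    ⨍ z in Metric.closedBall x.2 r, A (u x.1) z ∂(Λ.measure d)
  have hF : ∀ r, StronglyMeasurable (F r) := fun r =>
    stronglyMeasurable_apply_of_continuous
      (Ψ := fun (x : Ω × EuclideanSpace ℝ (Fin d)) v =>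
        ⨍ z in Metric.closedBall x.2 r, A v z ∂(Λ.measure d))
      (fun v => (stronglyMeasurable_average_closedBall
        (Lp.stronglyMeasurable (A v)) r).comp_measurable measurable_snd)
      (fun x => (continuous_average_closedBall x.2 r).comp A.continuous)
      (hu.comp_measurable measurable_fst)
  let l : Filter ℚ := comap (Rat.cast : ℚ → ℝ) (𝓝[>] 0)
  have hl : l.NeBot := neBot_comap_ratCast_nhdsGT
  -- the limit exists along rational radii if and only if the Cauchy condition holds, and that
  -- only involves countably many real functions
  let C : Set (Ω × EuclideanSpace ℝ (Fin d)) :=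
    {x | Tendsto (fun p : ℚ × ℚ => dist (F p.1 x) (F p.2 x)) (l ×ˢ l) (𝓝 0)}
  have hC : MeasurableSet C := measurableSet_tendsto (𝓝 0) fun p =>
    ((hF p.1).dist (hF p.2)).measurable
  have hCae : ∀ᵐ x ∂ρ.prod (Λ.measure d), x ∈ C := by
    rw [Measure.ae_prod_mem_iff_ae_ae_mem hC]
    refine Eventually.of_forall fun ω => ?_
    filter_upwards [ae_hasPointValue (A (u ω))] with y hy
    have hy' : Tendsto (fun q : ℚ => F q (ω, y)) l (𝓝 (A (u ω) y)) :=
      Tendsto.comp hy tendsto_comap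
    have := cauchy_map_iff'.1 hy'.cauchy_map
    exact tendsto_uniformity_iff_dist_tendsto_zero.1 this
  have hsupp : ∀ᵐ x ∂ρ.prod (Λ.measure d), x.2 ∈ (Λ.measure d).support :=
    Measure.quasiMeasurePreserving_snd.ae Measure.support_mem_ae
  have hex : ∀ᵐ x ∂ρ.prod (Λ.measure d), ∃ v, HasPointValue Λ (A (u x.1)) x.2 v := by
    filter_upwards [hCae, hsupp] with x hx hxs
    have hc : Cauchy (map (fun q : ℚ => F q x) l) :=
      cauchy_map_iff'.2 (tendsto_uniformity_iff_dist_tendsto_zero.2 hx)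
    obtain ⟨v, hv⟩ := CompleteSpace.complete hc
    refine ⟨v, tendsto_nhdsGT_of_tendsto_rat (fun r hr => ?_) hv⟩
    exact continuousWithinAt_average_closedBall
      ((Lp.memLp _).locallyIntegrable one_le_two) hxs hr
  refine ⟨hex, aestronglyMeasurable_of_tendsto_ae atTop
    (f := fun (n : ℕ) x => F (1 / ((n : ℝ) + 1)) x) (fun n => (hF _).aestronglyMeasurable) ?_⟩
  filter_upwards [hex] with x hx
  obtain ⟨v, hv⟩ := hx
  rw [hv.pointValue_eq]
  refine Tendsto.comp hv (tendsto_nhdsWithin_iff.2 ⟨tendsto_one_div_add_atTop_nhds_zero_nat, ?_⟩)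
  exact Eventually.of_forall fun n => by
    simp only [mem_Ioi]
    positivity

end PointValue

/-! ### Mean square isometry of the single-point reduction -/

section Reduction

variable {H : Type*} [NormedAddCommGroup H] [InnerProductSpace ℂ H] [CompleteSpace H] {d : ℕ}
  {ħ : ℝ} {Λ : PointerScale} {W : EuclideanSpace ℝ (Fin d) → (H ≃ₗᵢ[ℂ] H)}

theorem PointerState.law_absolutelyContinuous (f : PointerState d Λ) : f.law ≪ Λ.measure d :=
  withDensity_absolutelyContinuous _ _

/-- The values `f₀(z) G(z) ζ` form a representative of `S (ζ ⊗ f₀)`. -/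
theorem smul_reductionG_ae_eq (hħ : 0 < ħ) (hW : ∀ ζ, StronglyMeasurable fun p => W p ζ)
    (f : PointerState d Λ) (ζ : H) :
    (fun z => f.f₀ z • reductionG ħ W f z ζ) =ᵐ[Λ.measure d]
      scatter ħ Λ W fun z => f.f₀ z • ζ := by
  obtain ⟨A, hA⟩ := exists_linearIsometry_scatter (H := H) hħ hW f
  filter_upwards [f.ne_zero, ae_hasPointValue (A ζ), hA ζ] with z hz hv hAz
  rw [reductionG, smul_inv_smul₀ hz,
    ((hasPointValue_congr (hA ζ) z _).2 hv).pointValue_eq, hAz]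

theorem lintegral_reductionG (hħ : 0 < ħ) (hW : ∀ ζ, StronglyMeasurable fun p => W p ζ)
    (f : PointerState d Λ) (ζ : H) :
    ∫⁻ z, ‖reductionG ħ W f z ζ‖ₑ ^ 2 ∂f.law = ‖ζ‖ₑ ^ 2 := by
  obtain ⟨A, hA⟩ := exists_linearIsometry_scatter (H := H) hħ hW f
  have h1 := smul_reductionG_ae_eq hħ hW f ζ
  rw [PointerState.law, lintegral_withDensity_eq_lintegral_mul_non_measurable₀ _
    (f.aestronglyMeasurable.enorm.pow_const 2)
    (Eventually.of_forall fun z => ENNReal.pow_lt_top enorm_lt_top)]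
  have h2 : ‖ζ‖ₑ ^ 2 = ∫⁻ z, ‖A ζ z‖ₑ ^ 2 ∂Λ.measure d := by
    rw [← eLpNorm_two_sq, ← Lp.enorm_def, A.enorm_map]
  rw [h2]
  refine lintegral_congr_ae ?_
  filter_upwards [h1, hA ζ] with z hz hAz
  rw [← hAz, ← hz, Pi.mul_apply, enorm_smul, mul_pow]

/-- The reduction `G(y)` applied to a random vector `u` that is independent of `y`: it is almost surely
defined, measurable, and isometric in mean square. -/
theorem reductionG_prod (hħ : 0 < ħ) (hW : ∀ ζ, StronglyMeasurable fun p => W p ζ)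
    (f : PointerState d Λ) {Ω : Type*} [MeasurableSpace Ω] {ρ : Measure Ω} [SFinite ρ] {u : Ω → H}
    (hu : AEStronglyMeasurable u ρ) :
    (∀ᵐ x ∂ρ.prod f.law, InDomainG ħ W f x.2 (u x.1)) ∧
    AEStronglyMeasurable (fun x : Ω × EuclideanSpace ℝ (Fin d) => reductionG ħ W f x.2 (u x.1))
      (ρ.prod f.law) ∧
    ∫⁻ x, ‖reductionG ħ W f x.2 (u x.1)‖ₑ ^ 2 ∂ρ.prod f.law = ∫⁻ ω, ‖u ω‖ₑ ^ 2 ∂ρ := by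
  obtain ⟨A, hA⟩ := exists_linearIsometry_scatter (H := H) hħ hW f
  obtain ⟨h1, h2⟩ := ae_prod_hasPointValue A (ρ := ρ) hu.stronglyMeasurable_mk
  have hac : ρ.prod f.law ≪ ρ.prod (Λ.measure d) :=
    Measure.AbsolutelyContinuous.rfl.prod f.law_absolutelyContinuous
  have hmk : ∀ᵐ x ∂ρ.prod f.law, u x.1 = hu.mk u x.1 :=
    Measure.quasiMeasurePreserving_fst.ae hu.ae_eq_mk
  have hm : AEStronglyMeasurable (fun x : Ω × EuclideanSpace ℝ (Fin d) =>
      reductionG ħ W f x.2 (u x.1)) (ρ.prod f.law) := by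
    have hf : AEStronglyMeasurable (fun x : Ω × EuclideanSpace ℝ (Fin d) => (f.f₀ x.2)⁻¹)
        (ρ.prod f.law) := by
      have h := (f.aestronglyMeasurable.mono_ac
        f.law_absolutelyContinuous).comp_quasiMeasurePreserving
          (Measure.quasiMeasurePreserving_snd (μ := ρ) (ν := f.law))
      exact h.aemeasurable.inv.aestronglyMeasurable
    refine (hf.smul (h2.mono_ac hac)).congr ?_
    filter_upwards [hmk, hac.ae_le h1] with x hx hv
    obtain ⟨v, hv⟩ := hv
    rw [reductionG, hx, Pi.smul_apply', hv.pointValue_eq,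
      ((hasPointValue_congr (hA _) _ _).2 hv).pointValue_eq]
  refine ⟨?_, hm, ?_⟩
  · filter_upwards [hmk, hac.ae_le h1] with x hx hv
    obtain ⟨v, hv⟩ := hv
    exact ⟨v, by rw [hx]; exact (hasPointValue_congr (hA _) _ _).2 hv⟩
  · rw [lintegral_prod _ (hm.enorm.pow_const 2)]
    simp only [lintegral_reductionG hħ hW f]

end Reduction

/-! ### Kick times -/

section KickTimes

variable (τ : KickTimes)

theorem lt_kickCount_iff (t : ℝ) (n : ℕ) : n < kickCount τ t ↔ τ n < t := by
  classical
  have hex : ∃ N, t ≤ τ N := (τ.2.2.2.eventually_ge_atTop t).exists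
  have hset : {n | τ n < t} = ↑(Finset.range (Nat.find hex)) := by
    ext n
    simp only [mem_ofPred_eq, Finset.coe_range, mem_Iio]
    constructor
    · intro h
      by_contra hle
      exact absurd (τ.2.2.1.monotone (not_lt.1 hle)) (not_le.2 (h.trans_le (Nat.find_spec hex)))
    · exact fun h => not_le.1 (Nat.find_min hex h)
  have hmem : τ n < t ↔ n ∈ {n | τ n < t} := Iff.rfl
  rw [hmem, kickCount, hset, Set.ncard_coe_finset, Finset.card_range, Finset.coe_range, mem_Iio]

theorem kickCount_eq_iff (t : ℝ) (N : ℕ) :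
    kickCount τ t = N ↔ (∀ n < N, τ n < t) ∧ t ≤ τ N := by
  constructor
  · rintro rfl
    exact ⟨fun n hn => (lt_kickCount_iff τ t n).1 hn,
      not_lt.1 fun h => lt_irrefl _ ((lt_kickCount_iff τ t _).2 h)⟩
  · rintro ⟨h1, h2⟩
    refine le_antisymm ?_ ?_
    · by_contra h
      exact absurd ((lt_kickCount_iff τ t N).1 (not_le.1 h)) (not_lt.2 h2)
    · by_contra h
      exact lt_irrefl _ ((lt_kickCount_iff τ t _).2 (h1 _ (not_le.1 h)))

/-- The kick at the time `τ n` itself is not counted, as `n_t` counts the kicks strictly before `t`. -/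
theorem kickCount_apply (n : ℕ) : kickCount τ (τ n) = n :=
  (kickCount_eq_iff τ _ _).2 ⟨fun _ hk => τ.2.2.1 hk, le_rfl⟩

theorem kickCount_zero : kickCount τ 0 = 0 :=
  (kickCount_eq_iff τ _ _).2 ⟨fun _ hk => absurd hk (Nat.not_lt_zero _), (τ.2.1 0).le⟩

theorem eventually_kickCount_eq_left (t : ℝ) :
    ∀ᶠ s in 𝓝[≤] t, kickCount τ s = kickCount τ t := by
  obtain ⟨h1, h2⟩ := (kickCount_eq_iff τ t _).1 rfl
  have h3 : ∀ᶠ s in 𝓝 t, ∀ n ∈ Finset.range (kickCount τ t), τ n < s :=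
    (Finset.eventually_all _).2 fun n hn => Ioi_mem_nhds (h1 n (Finset.mem_range.1 hn))
  filter_upwards [nhdsWithin_le_nhds h3, self_mem_nhdsWithin] with s hs hst
  exact (kickCount_eq_iff τ s _).2 ⟨fun n hn => hs n (Finset.mem_range.2 hn), le_trans hst h2⟩

theorem exists_eventually_kickCount_eq_right (t : ℝ) :
    ∃ M, ∀ᶠ s in 𝓝[>] t, kickCount τ s = M := by
  classical
  have hex : ∃ N, t < τ N := (τ.2.2.2.eventually_gt_atTop t).exists
  refine ⟨Nat.find hex, ?_⟩
  filter_upwards [Ioo_mem_nhdsGT (Nat.find_spec hex)] with s hs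
  exact (kickCount_eq_iff τ s _).2
    ⟨fun n hn => (not_lt.1 (Nat.find_min hex hn)).trans_lt hs.1, hs.2.le⟩

end KickTimes

/-! ### Left continuous functions with right limits -/

section Regulated

/-- A function on `[0, ∞)` that is left continuous with right limits is locally integrable: it is a
limit of its discretizations from the left, and bounded on compact intervals. -/
theorem intervalIntegrable_of_left_continuous {g : ℝ → ℂ}
    (hl : ∀ t, 0 < t → ContinuousWithinAt g (Iic t) t)
    (hr : ∀ t, 0 ≤ t → ∃ v, Tendsto g (𝓝[>] t) (𝓝 v)) {t : ℝ} (ht : 0 ≤ t) :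
    IntervalIntegrable g volume 0 t := by
  have hbd : ∃ C, ∀ s ∈ Icc 0 t, ‖g s‖ ≤ C := by
    refine isCompact_Icc.induction_on (p := fun A : Set ℝ => ∃ C, ∀ s ∈ A, ‖g s‖ ≤ C) ?_ ?_ ?_ ?_
    · exact ⟨0, fun s hs => hs.elim⟩
    · exact fun A B hAB ⟨C, hC⟩ => ⟨C, fun s hs => hC s (hAB hs)⟩
    · rintro A B ⟨C, hC⟩ ⟨C', hC'⟩
      exact ⟨max C C', fun s hs => hs.elim (fun h => (hC s h).trans (le_max_left _ _))
        fun h => (hC' s h).trans (le_max_right _ _)⟩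
    · intro x hx
      obtain ⟨v, hv⟩ := hr x hx.1
      have h1 : ∀ᶠ s in 𝓝[>] x, ‖g s‖ < ‖v‖ + 1 := hv.norm.eventually_lt_const (lt_add_one _)
      have h2 : ∀ᶠ s in 𝓝[≤] x, 0 ≤ s → ‖g s‖ < ‖g x‖ + 1 := by
        rcases hx.1.eq_or_lt with h0 | h0
        · filter_upwards [self_mem_nhdsWithin] with s hs h
          rw [show s = x from le_antisymm hs (h0 ▸ h)]
          exact lt_add_one _
        · filter_upwards [(hl x h0).norm.eventually_lt_const (lt_add_one _)] with s hs _
          exact hs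
      have h3 : ∀ᶠ s in 𝓝 x, 0 ≤ s → ‖g s‖ ≤ max (‖v‖ + 1) (‖g x‖ + 1) := by
        rw [← nhdsLE_sup_nhdsGT, eventually_sup]
        exact ⟨h2.mono fun s hs h => (hs h).le.trans (le_max_right _ _),
          h1.mono fun s hs _ => hs.le.trans (le_max_left _ _)⟩
      refine ⟨{s | 0 ≤ s → ‖g s‖ ≤ max (‖v‖ + 1) (‖g x‖ + 1)} ∩ Icc 0 t,
        inter_mem (nhdsWithin_le_nhds h3) self_mem_nhdsWithin, _, fun s hs => hs.1 hs.2.1⟩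
  obtain ⟨C, hC⟩ := hbd
  have hm : AEStronglyMeasurable g (volume.restrict (Ioc 0 t)) := by
    -- the last point of the grid of mesh `1 / (n + 1)` strictly to the left of `s`
    let a : ℕ → ℝ → ℝ := fun n s => ((⌈((n : ℝ) + 1) * s⌉ : ℝ) - 1) / ((n : ℝ) + 1)
    refine aestronglyMeasurable_of_tendsto_ae atTop (f := fun n s => g (a n s)) (fun n => ?_) ?_
    · have : Measurable fun s : ℝ => ⌈((n : ℝ) + 1) * s⌉ :=
        Int.measurable_ceil.comp (measurable_const_mul _)
      exact ((measurable_from_top (f := fun k : ℤ => g (((k : ℝ) - 1) / ((n : ℝ) + 1)))).comp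
        this).aestronglyMeasurable
    · filter_upwards [ae_restrict_mem measurableSet_Ioc] with s hs
      refine Tendsto.comp (hl s hs.1) (tendsto_nhdsWithin_iff.2 ⟨?_, Eventually.of_forall fun n => ?_⟩)
      · refine tendsto_of_tendsto_of_tendsto_of_le_of_le (g := fun n : ℕ => s - 1 / ((n : ℝ) + 1))
          (h := fun _ => s) ?_ tendsto_const_nhds (fun n => ?_) (fun n => ?_)
        · simpa using tendsto_const_nhds.sub (tendsto_one_div_add_atTop_nhds_zero_nat (𝕜 := ℝ))
        · have hn : (0 : ℝ) < (n : ℝ) + 1 := by positivity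
          have := Int.le_ceil (((n : ℝ) + 1) * s)
          simp only [a]
          rw [le_div_iff₀ hn, sub_mul, one_div, inv_mul_cancel₀ hn.ne']
          linarith
        · have hn : (0 : ℝ) < (n : ℝ) + 1 := by positivity
          have := Int.ceil_lt_add_one (((n : ℝ) + 1) * s)
          simp only [a]
          rw [div_le_iff₀ hn]
          linarith
      · have hn : (0 : ℝ) < (n : ℝ) + 1 := by positivity
        have := Int.ceil_lt_add_one (((n : ℝ) + 1) * s)
        simp only [a, mem_Iic]
        rw [div_le_iff₀ hn]
        linarith
  rw [intervalIntegrable_iff_integrableOn_Ioc_of_le ht]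
  refine IntegrableOn.of_bound (by simp) hm C ?_
  filter_upwards [ae_restrict_mem measurableSet_Ioc] with s hs
  exact hC s ⟨hs.1.le, hs.2⟩

theorem intervalIntegrable_inner_of_left_continuous {H : Type*} [NormedAddCommGroup H]
    [InnerProductSpace ℂ H] {w : ℝ → H} (hl : ∀ t, 0 < t → ContinuousWithinAt w (Iic t) t)
    (hr : ∀ t, 0 ≤ t → ∃ v, Tendsto w (𝓝[>] t) (𝓝 v)) (ψ : H) {t : ℝ} (ht : 0 ≤ t) :
    IntervalIntegrable (fun s => inner ℂ ψ (w s)) volume 0 t :=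
  intervalIntegrable_of_left_continuous
    (fun s hs => continuousWithinAt_const.inner (hl s hs))
    (fun s hs => (hr s hs).elim fun _ hv => ⟨_, tendsto_const_nhds.inner hv⟩) ht

end Regulated

/-! ### The free evolution -/

section Free

variable {H : Type*} [NormedAddCommGroup H] [InnerProductSpace ℂ H] {ħ : ℝ} {Ham : H →ₗ.[ℂ] H}
  {U : ℝ → (H ≃ₗᵢ[ℂ] H)}

theorem IsUnitaryGroup.symm_apply (hU : IsUnitaryGroup ħ Ham U) (t : ℝ) (x : H) :
    (U t).symm x = U (-t) x := by
  rw [LinearIsometryEquiv.symm_apply_eq, ← hU.add, add_neg_cancel, hU.zero]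

theorem IsUnitaryGroup.inner_apply (hU : IsUnitaryGroup ħ Ham U) (t : ℝ) (x y : H) :
    inner ℂ x (U t y) = inner ℂ (U (-t) x) y := by
  rw [← (U t).inner_map_map (U (-t) x) y, ← hU.add, add_neg_cancel, hU.zero]

theorem IsUnitaryGroup.hasDerivAt (hU : IsUnitaryGroup ħ Ham U) (φ : Ham.domain) (t : ℝ) :
    HasDerivAt (fun s => U s φ) (-(Complex.I / (ħ : ℂ)) • U t (Ham φ)) t := by
  have h0 : HasDerivAt (fun s => U s φ) (-(Complex.I / (ħ : ℂ)) • Ham φ) 0 :=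
    (hU.generator _ _).1 (Ham.mem_graph φ)
  have h1 : HasDerivAt (fun s => U (s - t) (φ : H)) (-(Complex.I / (ħ : ℂ)) • Ham φ) t := by
    refine HasDerivAt.comp_sub_const (f := fun s => U s (φ : H)) t t ?_
    rwa [sub_self]
  have h2 := (U t).toContinuousLinearEquiv.toContinuousLinearMap.restrictScalars ℝ
    |>.hasFDerivAt.comp_hasDerivAt t h1
  rw [← map_smul]
  refine HasDerivAt.congr_of_eventuallyEq h2 (Eventually.of_forall fun s => ?_)
  change U s φ = U t (U (s - t) φ)
  rw [← hU.add, add_sub_cancel]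

/-- The evolution preserves the domain of the Hamiltonian and commutes with it. -/
theorem IsUnitaryGroup.mem_graph (hU : IsUnitaryGroup ħ Ham U) (φ : Ham.domain) (t : ℝ) :
    (U t φ, U t (Ham φ)) ∈ Ham.graph := by
  rw [hU.generator]
  have h := hU.hasDerivAt φ t
  have h1 : HasDerivAt (fun s => U (s + t) (φ : H)) (-(Complex.I / (ħ : ℂ)) • U t (Ham φ)) 0 := by
    refine HasDerivAt.comp_add_const (f := fun s => U s (φ : H)) 0 t ?_
    rwa [zero_add]
  simpa only [hU.add] using h1

theorem IsUnitaryGroup.integral_inner (hU : IsUnitaryGroup ħ Ham U) (φ : Ham.domain) (v : H)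
    (a t : ℝ) :
    Complex.I / (ħ : ℂ) * ∫ s in a..t, inner ℂ (Ham φ) (U s v) =
      inner ℂ (φ : H) (U a v) - inner ℂ (φ : H) (U t v) := by
  have hd : ∀ s, HasDerivAt (fun s => inner ℂ (φ : H) (U s v))
      (-(Complex.I / (ħ : ℂ)) * inner ℂ (Ham φ) (U s v)) s := by
    intro s
    have h1 : HasDerivAt (fun s => U (-s) (φ : H)) (-(-(Complex.I / (ħ : ℂ)) • U (-s) (Ham φ))) s := by
      have := (hU.hasDerivAt φ (-s)).scomp s (hasDerivAt_neg s)
      rwa [neg_one_smul] at this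
    have h2 := h1.inner ℂ (hasDerivAt_const s v)
    have hval : inner ℂ (U (-s) (φ : H)) 0 +
        inner ℂ (-(-(Complex.I / (ħ : ℂ)) • U (-s) (Ham φ))) v =
        -(Complex.I / (ħ : ℂ)) * inner ℂ (Ham φ) (U s v) := by
      rw [inner_zero_right, zero_add, inner_neg_left, inner_smul_left, ← hU.inner_apply]
      simp only [map_neg, map_div₀, Complex.conj_I, Complex.conj_ofReal]
      ring
    rw [hval] at h2
    simpa only [← hU.inner_apply] using h2
  have hc : Continuous fun s => -(Complex.I / (ħ : ℂ)) * inner ℂ (Ham φ) (U s v) :=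
    continuous_const.mul (continuous_const.inner (hU.continuous v))
  have := intervalIntegral.integral_eq_sub_of_hasDerivAt (fun s _ => hd s)
    (hc.intervalIntegrable a t)
  rw [intervalIntegral.integral_const_mul] at this
  linear_combination -this

/-- A weak solution of the free Schrödinger equation with initial value `0` vanishes if it is left
continuous with right limits. The equation makes it weakly continuous, so that its right limits are
its values and it is norm continuous; then `⟨U s φ, w s⟩` has right derivative zero for `φ` in the
domain of the Hamiltonian. -/
theorem IsUnitaryGroup.eq_zero_of_weak_solution (hU : IsUnitaryGroup ħ Ham U)
    (hdom : Dense (Ham.domain : Set H)) {w : ℝ → H}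
    (hl : ∀ t, 0 < t → ContinuousWithinAt w (Iic t) t)
    (hr : ∀ t, 0 ≤ t → ∃ v, Tendsto w (𝓝[>] t) (𝓝 v))
    (hw : ∀ (φ : Ham.domain) (t : ℝ), 0 ≤ t →
      inner ℂ (φ : H) (w t) + Complex.I / (ħ : ℂ) * ∫ s in (0 : ℝ)..t, inner ℂ (Ham φ) (w s) = 0) :
    ∀ t, 0 ≤ t → w t = 0 := by
  have hint : ∀ (ψ : H) {t : ℝ}, 0 ≤ t →
      IntervalIntegrable (fun s => inner ℂ ψ (w s)) volume 0 t := fun ψ _ ht =>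
    intervalIntegrable_inner_of_left_continuous hl hr ψ ht
  have hval : ∀ (φ : Ham.domain) (t : ℝ), 0 ≤ t → inner ℂ (φ : H) (w t) =
      -(Complex.I / (ħ : ℂ)) * ∫ s in (0 : ℝ)..t, inner ℂ (Ham φ) (w s) := fun φ t ht => by
    linear_combination hw φ t ht
  have hzero : ∀ v : H, (∀ φ : Ham.domain, inner ℂ (φ : H) v = 0) → v = 0 := by
    intro v hv
    refine hdom.eq_zero_of_inner_right (𝕜 := ℂ) fun φ hφ => hv ⟨φ, hφ⟩
  have hright : ∀ t, 0 ≤ t → ContinuousWithinAt w (Ioi t) t := by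
    intro t ht
    obtain ⟨v, hv⟩ := hr t ht
    suffices v = w t by rwa [this] at hv
    rw [← sub_eq_zero]
    refine hzero _ fun φ => ?_
    rw [inner_sub_right, sub_eq_zero]
    have h1 : Tendsto (fun s => inner ℂ (φ : H) (w s)) (𝓝[>] t) (𝓝 (inner ℂ (φ : H) v)) :=
      tendsto_const_nhds.inner hv
    have h2 : ContinuousOn (fun s => ∫ r in (0 : ℝ)..s, inner ℂ (Ham φ) (w r)) (Icc 0 (t + 1)) := by
      have := intervalIntegral.continuousOn_primitive_interval (μ := volume) (a := 0) (b := t + 1)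
        (f := fun s => inner ℂ (Ham φ) (w s)) ?_
      · rwa [uIcc_of_le (by linarith)] at this
      · have := hint (Ham φ) (t := t + 1) (by linarith)
        rw [intervalIntegrable_iff_integrableOn_Icc_of_le (by linarith)] at this
        rwa [uIcc_of_le (by linarith)]
    have h3 : Tendsto (fun s => inner ℂ (φ : H) (w s)) (𝓝[>] t) (𝓝 (inner ℂ (φ : H) (w t))) := by
      rw [hval φ t ht]
      have h4 : Tendsto (fun s => ∫ r in (0 : ℝ)..s, inner ℂ (Ham φ) (w r)) (𝓝[>] t)
          (𝓝 (∫ r in (0 : ℝ)..t, inner ℂ (Ham φ) (w r))) := by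
        refine (h2 t ⟨ht, by linarith⟩).mono_left ?_
        rw [nhdsWithin_le_iff]
        filter_upwards [Ioo_mem_nhdsGT (lt_add_one t)] with s hs
        exact ⟨ht.trans hs.1.le, hs.2.le⟩
      refine (h4.const_mul _).congr' ?_
      filter_upwards [self_mem_nhdsWithin] with s hs
      exact (hval φ s (ht.trans (le_of_lt hs))).symm
    exact tendsto_nhds_unique h1 h3
  have hcont : ContinuousOn w (Ici 0) := by
    intro t ht
    have h1 : ContinuousWithinAt w (Ici t) t := continuousWithinAt_Ioi_iff_Ici.1 (hright t ht)
    rcases (mem_Ici.1 ht).eq_or_lt with h0 | h0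
    · rwa [← h0] at h1 ⊢
    · exact (continuousAt_iff_continuous_left_right.2 ⟨hl t h0, h1⟩).continuousWithinAt
  have h00 : w 0 = 0 := hzero _ fun φ => by simpa using hval φ 0 le_rfl
  intro t ht
  have hconst : ∀ φ : Ham.domain, inner ℂ (U t φ) (w t) = 0 := by
    intro φ
    have hF := constant_of_has_deriv_right_zero (f := fun s => inner ℂ (U s (φ : H)) (w s))
      (a := 0) (b := t) ?_ ?_ t ⟨ht, le_rfl⟩
    · simpa [h00] using hF
    · exact (hU.continuous _).continuousOn.inner (hcont.mono fun s hs => hs.1)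
    · intro x hx
      obtain ⟨ψ, hψ1, hψ2⟩ := (Ham.mem_graph_iff).1 (hU.mem_graph φ x)
      have hcx : ContinuousWithinAt (fun s => inner ℂ (Ham ψ) (w s)) (Ioi x) x :=
        continuousWithinAt_const.inner (hright x hx.1)
      have h1 : HasDerivWithinAt (fun s => ∫ r in (0 : ℝ)..s, inner ℂ (Ham ψ) (w r))
          (inner ℂ (Ham ψ) (w x)) (Ici x) x := by
        refine intervalIntegral.integral_hasDerivWithinAt_right (hint _ hx.1) (t := Ioi x) ?_ hcx
        have : ContinuousOn (fun s => inner ℂ (Ham ψ) (w s)) (Ioi x) :=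
          continuousOn_const.inner (hcont.mono fun s hs => hx.1.trans (le_of_lt hs))
        exact ⟨Ioi x, self_mem_nhdsWithin, this.aestronglyMeasurable measurableSet_Ioi⟩
      have h2 : HasDerivWithinAt (fun s => inner ℂ (ψ : H) (w s))
          (-(Complex.I / (ħ : ℂ)) * inner ℂ (Ham ψ) (w x)) (Ici x) x := by
        refine (h1.const_mul (-(Complex.I / (ħ : ℂ)))).congr (fun s hs => ?_) ?_
        · exact hval ψ s (hx.1.trans hs)
        · exact hval ψ x hx.1
      have h3 := (hU.hasDerivAt φ x).hasDerivWithinAt (s := Ici x)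
      rw [hasDerivWithinAt_iff_tendsto_slope] at h2 h3 ⊢
      have hwx : Tendsto w (𝓝[Ici x \ {x}] x) (𝓝 (w x)) :=
        (hright x hx.1).mono_left (by rw [Ici_sdiff_left])
      -- product rule: `w` itself is only weakly differentiable, so the difference quotient is split
      -- into one of `U s φ`, paired with the norm convergent `w s`, and one of `⟨U x φ, w s⟩`
      have h4 := (h3.inner hwx (𝕜 := ℂ)).add h2
      have hlim : inner ℂ (-(Complex.I / (ħ : ℂ)) • U x (Ham φ)) (w x) +
          -(Complex.I / (ħ : ℂ)) * inner ℂ (Ham ψ) (w x) = 0 := by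
        rw [inner_smul_left, hψ2]
        simp only [map_neg, map_div₀, Complex.conj_I, Complex.conj_ofReal]
        ring
      rw [hlim] at h4
      refine h4.congr fun s => ?_
      simp only [slope, vsub_eq_sub, hψ1]
      rw [← Complex.coe_smul, inner_smul_left, inner_sub_left, Complex.conj_ofReal]
      simp only [Complex.real_smul]
      ring
  have h5 : (U t).symm (w t) = 0 := by
    refine hzero _ fun φ => ?_
    rw [← hconst φ, ← (U t).inner_map_map (φ : H), LinearIsometryEquiv.apply_symm_apply]
  simpa using h5

end Free

/-! ### Paths with kicks -/

section Paths

variable {H : Type*} [NormedAddCommGroup H] [InnerProductSpace ℂ H] {ħ : ℝ} {Ham : H →ₗ.[ℂ] H}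
  {U : ℝ → (H ≃ₗᵢ[ℂ] H)} {d : ℕ}

/-- The path that is at the time `t` the free evolution of the vector `c n`, with `n = n_t(τ)` the
number of kicks before `t`. -/
def kickPath (U : ℝ → (H ≃ₗᵢ[ℂ] H)) (τ : KickTimes) (c : ℕ → H) (t : ℝ) : H :=
  U t (c (kickCount τ t))

theorem kickPath_apply_time (τ : KickTimes) (c : ℕ → H) (n : ℕ) :
    kickPath U τ c (τ n) = U (τ n) (c n) := by
  rw [kickPath, kickCount_apply]

theorem IsUnitaryGroup.kickPath_left_continuous (hU : IsUnitaryGroup ħ Ham U) (τ : KickTimes)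
    (c : ℕ → H) (t : ℝ) : ContinuousWithinAt (kickPath U τ c) (Iic t) t := by
  refine ((hU.continuous (c (kickCount τ t))).continuousWithinAt).congr_of_eventuallyEq ?_ rfl
  filter_upwards [eventually_kickCount_eq_left τ t] with s hs
  rw [kickPath, hs]

theorem IsUnitaryGroup.kickPath_right_limit (hU : IsUnitaryGroup ħ Ham U) (τ : KickTimes)
    (c : ℕ → H) (t : ℝ) : ∃ v, Tendsto (kickPath U τ c) (𝓝[>] t) (𝓝 v) := by
  obtain ⟨M, hM⟩ := exists_eventually_kickCount_eq_right τ t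
  refine ⟨U t (c M), Tendsto.congr' ?_
    (((hU.continuous (c M)).tendsto t).mono_left nhdsWithin_le_nhds)⟩
  filter_upwards [hM] with s hs
  rw [kickPath, hs]

/-- A path with jumps `j k` at the kicks solves the weak equation driven by these jumps. By
linearity it is the superposition of the free evolutions of `η` and of the jumps, each of the
latter starting at its own kick. -/
theorem IsUnitaryGroup.kickPath_weak_equation (hU : IsUnitaryGroup ħ Ham U) (τ : KickTimes)
    (η : H) (j : ℕ → H) (φ : Ham.domain) {t : ℝ} (ht : 0 ≤ t) :
    let x := kickPath U τ fun n => η + ∑ k ∈ Finset.range n, (U (τ k)).symm (j k)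
    inner ℂ (φ : H) (x t) - inner ℂ (φ : H) η
        + Complex.I / (ħ : ℂ) * ∫ s in (0 : ℝ)..t, inner ℂ (Ham φ) (x s) =
      ∑ k ∈ Finset.range (kickCount τ t), inner ℂ (φ : H) (j k) := by
  intro x
  set N := kickCount τ t with hN
  have hxs : ∀ s ∈ Ioc 0 t, inner ℂ (Ham φ) (x s) = inner ℂ (Ham φ) (U s η) +
      ∑ k ∈ Finset.range N, (Ioi (τ k)).indicator
        (fun s => inner ℂ (Ham φ) (U s ((U (τ k)).symm (j k)))) s := by
    intro s hs
    have hle : kickCount τ s ≤ N := by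
      by_contra h
      have h1 := (lt_kickCount_iff τ s N).1 (not_le.1 h)
      exact lt_irrefl _ ((lt_kickCount_iff τ t N).2 (h1.trans_le hs.2))
    simp only [x, kickPath, map_add, map_sum, inner_add_right, inner_sum]
    congr 1
    rw [← Finset.sum_subset (Finset.range_mono hle)]
    · refine Finset.sum_congr rfl fun k hk => ?_
      rw [indicator_of_mem]
      exact (lt_kickCount_iff τ s k).1 (Finset.mem_range.1 hk)
    · intro k _ hk
      refine indicator_of_notMem (fun h => hk ?_) _
      exact Finset.mem_range.2 ((lt_kickCount_iff τ s k).2 h)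
  have hc : ∀ v, Continuous fun s => inner ℂ (Ham φ) (U s v) := fun v =>
    continuous_const.inner (hU.continuous v)
  have hint : ∀ v, IntegrableOn (fun s => inner ℂ (Ham φ) (U s v)) (Ioc 0 t) := fun v =>
    ((hc v).intervalIntegrable 0 t).1
  have hI : ∫ s in (0 : ℝ)..t, inner ℂ (Ham φ) (x s) =
      (∫ s in (0 : ℝ)..t, inner ℂ (Ham φ) (U s η)) +
        ∑ k ∈ Finset.range N, ∫ s in (τ k)..t, inner ℂ (Ham φ) (U s ((U (τ k)).symm (j k))) := by
    rw [intervalIntegral.integral_of_le ht, intervalIntegral.integral_of_le ht,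
      setIntegral_congr_fun measurableSet_Ioc hxs, integral_add (hint η),
      integral_finsetSum]
    · congr 1
      refine Finset.sum_congr rfl fun k hk => ?_
      have hk' : τ k < t := (lt_kickCount_iff τ t k).1 (Finset.mem_range.1 hk)
      rw [setIntegral_indicator measurableSet_Ioi, intervalIntegral.integral_of_le hk'.le]
      congr 2
      ext s
      simp only [mem_inter_iff, mem_Ioc, mem_Ioi]
      have := τ.2.1 k
      constructor
      · exact fun h => ⟨h.2, h.1.2⟩
      · exact fun h => ⟨⟨this.trans h.1, h.2⟩, h.1⟩
    · exact fun k _ => (hint _).indicator measurableSet_Ioi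
    · exact integrable_finsetSum _ fun k _ => (hint _).indicator measurableSet_Ioi
  rw [hI, mul_add, hU.integral_inner, Finset.mul_sum]
  simp only [hU.integral_inner, hU.zero, LinearIsometryEquiv.apply_symm_apply,
    Finset.sum_sub_distrib]
  simp only [x, kickPath, map_add, map_sum, inner_add_right, inner_sum, ← hN]
  ring

variable {D : EuclideanSpace ℝ (Fin d) → H → Prop} {G : EuclideanSpace ℝ (Fin d) → H → H} {η : H}
  {υ : Trajectory d}

theorem chronProduct_eq_sum (n : ℕ) :
    chronProduct U G υ η n = η + ∑ k ∈ Finset.range n, (U (υ.1 k)).symm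
      (G (υ.2 k) (U (υ.1 k) (chronProduct U G υ η k)) - U (υ.1 k) (chronProduct U G υ η k)) := by
  have : ∀ k, (U (υ.1 k)).symm
      (G (υ.2 k) (U (υ.1 k) (chronProduct U G υ η k)) - U (υ.1 k) (chronProduct U G υ η k)) =
      chronProduct U G υ η (k + 1) - chronProduct U G υ η k := by
    intro k
    rw [map_sub, LinearIsometryEquiv.symm_apply_apply]
    rfl
  simp only [this]
  rw [Finset.sum_range_sub, chronProduct, add_sub_cancel]

theorem reducedWave_apply_time (n : ℕ) :
    reducedWave U G η (υ.1 n) υ = U (υ.1 n) (chronProduct U G υ η n) :=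
  kickPath_apply_time υ.1 _ n

theorem solvesIntegralEquation_reducedWave
    (hD : ∀ n, D (υ.2 n) (U (υ.1 n) (chronProduct U G υ η n))) :
    SolvesIntegralEquation U D G η υ fun t => reducedWave U G η t υ where
  mem_domain n := by
    rw [reducedWave_apply_time]
    exact hD n
  equation t _ := by
    rw [reducedWave, chronProduct_eq_sum, countingIntegral]
    simp only [reducedWave_apply_time]

/-- The jumps of a solution of the integral equation are determined recursively by the vectors
before the earlier kicks. -/
theorem SolvesIntegralEquation.eq_reducedWave {x : ℝ → H}
    (hx : SolvesIntegralEquation U D G η υ x) {t : ℝ} (ht : 0 ≤ t) :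
    x t = reducedWave U G η t υ := by
  let S : ℕ → H := fun n =>
    η + ∑ k ∈ Finset.range n, (U (υ.1 k)).symm (G (υ.2 k) (x (υ.1 k)) - x (υ.1 k))
  have hxS : ∀ t, 0 ≤ t → x t = U t (S (kickCount υ.1 t)) := hx.equation
  have hS : ∀ n, S n = chronProduct U G υ η n := by
    intro n
    induction n with
    | zero => simp [S, chronProduct]
    | succ n ih =>
      have h1 : x (υ.1 n) = U (υ.1 n) (S n) := by
        rw [hxS _ (υ.1.2.1 n).le, kickCount_apply]
      have h2 : S (n + 1) = S n + (U (υ.1 n)).symm (G (υ.2 n) (x (υ.1 n)) - x (υ.1 n)) := by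
        simp only [S, Finset.sum_range_succ, add_assoc]
      rw [h2, h1, map_sub, LinearIsometryEquiv.symm_apply_apply, add_sub_cancel, ih]
      rfl
  rw [hxS t ht, hS]
  rfl

theorem IsUnitaryGroup.solvesWaveEquation_reducedWave (hU : IsUnitaryGroup ħ Ham U)
    (hD : ∀ n, D (υ.2 n) (U (υ.1 n) (chronProduct U G υ η n))) :
    SolvesWaveEquation ħ Ham D G η υ fun t => reducedWave U G η t υ where
  initial := by
    rw [reducedWave, kickCount_zero, hU.zero, chronProduct]
  left_continuous t _ := hU.kickPath_left_continuous υ.1 _ t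
  right_limit t _ := hU.kickPath_right_limit υ.1 _ t
  mem_domain n := by
    rw [reducedWave_apply_time]
    exact hD n
  equation φ t ht := by
    have h := hU.kickPath_weak_equation υ.1 η
      (fun k => G (υ.2 k) (U (υ.1 k) (chronProduct U G υ η k)) - U (υ.1 k) (chronProduct U G υ η k))
      φ ht
    simp only [← chronProduct_eq_sum] at h
    rw [countingIntegral]
    simp only [reducedWave_apply_time]
    exact h

/-- A solution of the differential form solves the integral form with the same jumps: the difference
of the two sides is a weak solution of the free Schrödinger equation. -/
theorem IsUnitaryGroup.eq_reducedWave_of_solvesWaveEquation (hU : IsUnitaryGroup ħ Ham U)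
    (hdom : Dense (Ham.domain : Set H)) {x : ℝ → H} (hx : SolvesWaveEquation ħ Ham D G η υ x)
    {t : ℝ} (ht : 0 ≤ t) : x t = reducedWave U G η t υ := by
  let j : ℕ → H := fun k => G (υ.2 k) (x (υ.1 k)) - x (υ.1 k)
  let z := kickPath U υ.1 fun n => η + ∑ k ∈ Finset.range n, (U (υ.1 k)).symm (j k)
  have hzl := hU.kickPath_left_continuous υ.1
    fun n => η + ∑ k ∈ Finset.range n, (U (υ.1 k)).symm (j k)
  have hzr := hU.kickPath_right_limit υ.1
    fun n => η + ∑ k ∈ Finset.range n, (U (υ.1 k)).symm (j k)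
  have hxz : ∀ t, 0 ≤ t → x t - z t = 0 := by
    refine hU.eq_zero_of_weak_solution hdom (w := fun t => x t - z t)
      (fun t ht => (hx.left_continuous t ht).sub (hzl t)) (fun t ht => ?_) (fun φ t ht => ?_)
    · obtain ⟨v, hv⟩ := hx.right_limit t ht
      obtain ⟨v', hv'⟩ := hzr t
      exact ⟨v - v', hv.sub hv'⟩
    · have h1 := hx.equation φ t ht
      have h2 := hU.kickPath_weak_equation υ.1 η j φ ht
      have h3 : ∫ s in (0 : ℝ)..t, inner ℂ (Ham φ) (x s - z s) =
          (∫ s in (0 : ℝ)..t, inner ℂ (Ham φ) (x s)) - ∫ s in (0 : ℝ)..t, inner ℂ (Ham φ) (z s) := by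
        simp only [inner_sub_right]
        exact intervalIntegral.integral_sub
          (intervalIntegrable_inner_of_left_continuous hx.left_continuous hx.right_limit _ ht)
          (intervalIntegrable_inner_of_left_continuous (fun t _ => hzl t) (fun t _ => hzr t) _ ht)
      rw [h3, inner_sub_right]
      simp only [countingIntegral] at h1
      linear_combination h1 - h2
  refine SolvesIntegralEquation.eq_reducedWave (D := D) ⟨hx.mem_domain, fun s hs => ?_⟩ ht
  exact sub_eq_zero.1 (hxz s hs)

end Paths

/-! ### The chronological product as a random vector -/

section Random

theorem aestronglyMeasurable_apply_of_continuous {X E F : Type*} [MeasurableSpace X]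
    [TopologicalSpace E] [TopologicalSpace F] [TopologicalSpace.PseudoMetrizableSpace F]
    [AddCommMonoid F] [ContinuousAdd F] {μ : Measure X} {Ψ : X → E → F}
    (hm : ∀ v, StronglyMeasurable fun x => Ψ x v) (hc : ∀ x, Continuous (Ψ x))
    {u : X → E} (hu : AEStronglyMeasurable u μ) : AEStronglyMeasurable (fun x => Ψ x (u x)) μ :=
  ⟨_, stronglyMeasurable_apply_of_continuous hm hc hu.stronglyMeasurable_mk,
    hu.ae_eq_mk.mono fun x hx => by dsimp only; rw [hx]⟩

theorem memLp_two_of_lintegral_ne_top {X E : Type*} [MeasurableSpace X] [NormedAddCommGroup E]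
    {μ : Measure X} {g : X → E} (hg : AEStronglyMeasurable g μ)
    (h : ∫⁻ x, ‖g x‖ₑ ^ 2 ∂μ ≠ ∞) : MemLp g 2 μ := by
  refine ⟨hg, lt_top_iff_ne_top.2 fun htop => h ?_⟩
  rw [← eLpNorm_two_sq, htop, ENNReal.top_pow two_ne_zero]

variable {H : Type*} [NormedAddCommGroup H] [InnerProductSpace ℂ H] {d : ℕ}
  {ħ : ℝ} {Λ : PointerScale} {W : EuclideanSpace ℝ (Fin d) → (H ≃ₗᵢ[ℂ] H)}
  {Ham : H →ₗ.[ℂ] H} {U : ℝ → (H ≃ₗᵢ[ℂ] H)}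

theorem chronProduct_congr {G : EuclideanSpace ℝ (Fin d) → H → H} {η : H} (τ : KickTimes)
    {y y' : ℕ → EuclideanSpace ℝ (Fin d)} {n : ℕ} (h : ∀ i < n, y i = y' i) :
    chronProduct U G (τ, y) η n = chronProduct U G (τ, y') η n := by
  induction n with
  | zero => rfl
  | succ n ih =>
    simp only [chronProduct]
    rw [ih fun i hi => h i (hi.trans n.lt_succ_self), h n n.lt_succ_self]

theorem measurable_kickTimes_apply (n : ℕ) : Measurable fun τ : KickTimes => τ n :=
  (measurable_pi_apply n).comp measurable_subtype_coe

instance (f : PointerState d Λ) : IsProbabilityMeasure f.lawSeq :=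
  inferInstanceAs (IsProbabilityMeasure (Measure.infinitePi _))

/-- The law of the first `n` pointer values. -/
def PointerState.lawFirst (f : PointerState d Λ) (n : ℕ) :
    Measure (Finset.range n → EuclideanSpace ℝ (Fin d)) :=
  f.lawSeq.map (Finset.range n).restrict

instance (f : PointerState d Λ) (n : ℕ) : IsProbabilityMeasure (f.lawFirst n) :=
  Measure.isProbabilityMeasure_map (Finset.measurable_restrict _).aemeasurable

/-- The pointer value number `n` is independent of the earlier ones. -/
theorem PointerState.measurePreserving_restrict_eval (f : PointerState d Λ) (n : ℕ) :
    MeasurePreserving (fun y : ℕ → EuclideanSpace ℝ (Fin d) => ((Finset.range n).restrict y, y n))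
      f.lawSeq ((f.lawFirst n).prod f.law) := by
  refine ⟨(Finset.measurable_restrict _).prodMk (measurable_pi_apply n), ?_⟩
  have h1 : ProbabilityTheory.iIndepFun
      (fun (i : ℕ) (y : ℕ → EuclideanSpace ℝ (Fin d)) => y i) f.lawSeq :=
    ProbabilityTheory.iIndepFun_infinitePi (P := fun _ => f.law) (X := fun _ => id)
      fun _ => measurable_id
  have h2 := h1.indepFun_finset (Finset.range n) {n} (by simp) fun i => measurable_pi_apply i
  have hlast : Measurable fun v : ({n} : Finset ℕ) → EuclideanSpace ℝ (Fin d) =>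
      v ⟨n, Finset.mem_singleton_self n⟩ := measurable_pi_apply _
  have h3 := h2.comp measurable_id hlast
  have h4 := (ProbabilityTheory.indepFun_iff_map_prod_eq_prod_map_map
    (Finset.measurable_restrict (Finset.range n)).aemeasurable
    (measurable_pi_apply n).aemeasurable).1 h3
  have h5 : f.lawSeq.map (fun y => y n) = f.law := Measure.infinitePi_map_eval _ n
  rw [h5] at h4
  exact h4

/-- The first `n + 1` pointer values, split into the first `n` and the last one. -/
def splitLast (d n : ℕ) (v : Finset.range (n + 1) → EuclideanSpace ℝ (Fin d)) :
    (Finset.range n → EuclideanSpace ℝ (Fin d)) × EuclideanSpace ℝ (Fin d) :=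
  (fun i => v ⟨i, Finset.range_mono n.le_succ i.2⟩, v ⟨n, Finset.self_mem_range_succ n⟩)

theorem PointerState.measurePreserving_splitLast (f : PointerState d Λ) (n : ℕ) :
    MeasurePreserving (splitLast d n) (f.lawFirst (n + 1)) ((f.lawFirst n).prod f.law) := by
  have hm : Measurable (splitLast d n) :=
    (measurable_pi_lambda _ fun i => measurable_pi_apply _).prodMk (measurable_pi_apply _)
  refine ⟨hm, ?_⟩
  rw [PointerState.lawFirst, Measure.map_map hm (Finset.measurable_restrict _)]
  exact (f.measurePreserving_restrict_eval n).map_eq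

theorem measurePreserving_prodAssoc_symm_comp {α β γ δ : Type*} [MeasurableSpace α]
    [MeasurableSpace β] [MeasurableSpace γ] [MeasurableSpace δ] {μ : Measure α} {ν : Measure β}
    {ρ : Measure γ} {σ : Measure δ} [SFinite μ] [SFinite ν] [SFinite ρ] [SFinite σ]
    {g : δ → β × γ} (hg : MeasurePreserving g σ (ν.prod ρ)) :
    MeasurePreserving (fun p : α × δ => ((p.1, (g p.2).1), (g p.2).2)) (μ.prod σ)
      ((μ.prod ν).prod ρ) :=
  (measurePreserving_prodAssoc μ ν ρ).symm.comp ((MeasurePreserving.id μ).prod hg)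

/-- The chronological product of `n` reductions as a function of the first `n` pointer values; the
later values, on which it does not depend, are set to `0`. -/
def chronFirst (U : ℝ → (H ≃ₗᵢ[ℂ] H)) (G : EuclideanSpace ℝ (Fin d) → H → H) (η : H) (n : ℕ)
    (p : KickTimes × (Finset.range n → EuclideanSpace ℝ (Fin d))) : H :=
  chronProduct U G (p.1, fun i => if h : i ∈ Finset.range n then p.2 ⟨i, h⟩ else 0) η n

theorem chronFirst_restrict {G : EuclideanSpace ℝ (Fin d) → H → H} {η : H} (n : ℕ)
    (υ : Trajectory d) :
    chronFirst U G η n (υ.1, (Finset.range n).restrict υ.2) = chronProduct U G υ η n :=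
  chronProduct_congr υ.1 fun i hi => by
    simp [Finset.mem_range.2 hi]

theorem chronFirst_succ {G : EuclideanSpace ℝ (Fin d) → H → H} {η : H} (n : ℕ)
    (p : KickTimes × (Finset.range (n + 1) → EuclideanSpace ℝ (Fin d))) :
    chronFirst U G η (n + 1) p = (U (p.1 n)).symm (G (splitLast d n p.2).2
      (U (p.1 n) (chronFirst U G η n (p.1, (splitLast d n p.2).1)))) := by
  have h : chronProduct U G (p.1, fun i => if h : i ∈ Finset.range (n + 1) then p.2 ⟨i, h⟩ else 0)
      η n = chronFirst U G η n (p.1, (splitLast d n p.2).1) :=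
    chronProduct_congr p.1 fun i hi => by
      simp [splitLast, hi, hi.trans n.lt_succ_self]
  rw [chronFirst, chronProduct, h]
  simp [splitLast]

variable [CompleteSpace H]

/-- The reduction `G(t, y) = U(t)† G(y) U(t)` at a random time, applied to a random vector independent
of `y`. -/
theorem reductionG_step (hħ : 0 < ħ) (hU : IsUnitaryGroup ħ Ham U)
    (hW : ∀ ζ, StronglyMeasurable fun p => W p ζ)
    (f : PointerState d Λ) {Ω : Type*} [MeasurableSpace Ω] {ρ : Measure Ω} [SFinite ρ] {u : Ω → H}
    (hu : AEStronglyMeasurable u ρ) {t : Ω → ℝ} (ht : Measurable t) :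
    (∀ᵐ x ∂ρ.prod f.law, InDomainG ħ W f x.2 (U (t x.1) (u x.1))) ∧
    AEStronglyMeasurable (fun x : Ω × EuclideanSpace ℝ (Fin d) =>
      (U (t x.1)).symm (reductionG ħ W f x.2 (U (t x.1) (u x.1)))) (ρ.prod f.law) ∧
    ∫⁻ x, ‖(U (t x.1)).symm (reductionG ħ W f x.2 (U (t x.1) (u x.1)))‖ₑ ^ 2 ∂ρ.prod f.law =
      ∫⁻ ω, ‖u ω‖ₑ ^ 2 ∂ρ := by
  have h1 : AEStronglyMeasurable (fun ω => U (t ω) (u ω)) ρ :=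
    aestronglyMeasurable_apply_of_continuous (Ψ := fun ω v => U (t ω) v)
      (fun v => (hU.continuous v).stronglyMeasurable.comp_measurable ht)
      (fun ω => (U (t ω)).continuous) hu
  obtain ⟨h2, h3, h4⟩ := reductionG_prod hħ hW f h1
  refine ⟨h2, aestronglyMeasurable_apply_of_continuous
    (Ψ := fun (x : Ω × EuclideanSpace ℝ (Fin d)) v => (U (t x.1)).symm v) (fun v => ?_)
    (fun x => (U (t x.1)).symm.continuous) h3, ?_⟩
  · simp only [hU.symm_apply]
    exact (hU.continuous v).stronglyMeasurable.comp_measurable (ht.comp measurable_fst).neg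
  · simpa only [LinearIsometryEquiv.enorm_map] using h4

theorem chronFirst_memLp (hħ : 0 < ħ) (hU : IsUnitaryGroup ħ Ham U)
    (hW : ∀ ζ, StronglyMeasurable fun p => W p ζ) (f : PointerState d Λ) (η : H)
    (π : Measure KickTimes) [IsProbabilityMeasure π] (n : ℕ) :
    AEStronglyMeasurable (chronFirst U (reductionG ħ W f) η n) (π.prod (f.lawFirst n)) ∧
    ∫⁻ p, ‖chronFirst U (reductionG ħ W f) η n p‖ₑ ^ 2 ∂π.prod (f.lawFirst n) = ‖η‖ₑ ^ 2 := by
  induction n with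
  | zero =>
    refine ⟨aestronglyMeasurable_const (b := η), ?_⟩
    have : ∀ p, chronFirst U (reductionG ħ W f) η 0 p = η := fun p => rfl
    simp only [this, lintegral_const, measure_univ, mul_one]
  | succ n ih =>
    obtain ⟨-, h2, h3⟩ := reductionG_step hħ hU hW f ih.1
      ((measurable_kickTimes_apply n).comp measurable_fst)
    have hT := measurePreserving_prodAssoc_symm_comp (μ := π) (f.measurePreserving_splitLast n)
    have hcomp : chronFirst U (reductionG ħ W f) η (n + 1) =
        (fun x : (KickTimes × (Finset.range n → EuclideanSpace ℝ (Fin d))) ×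
          EuclideanSpace ℝ (Fin d) => (U (x.1.1 n)).symm
        (reductionG ħ W f x.2 (U (x.1.1 n) (chronFirst U (reductionG ħ W f) η n x.1)))) ∘
        fun p => ((p.1, (splitLast d n p.2).1), (splitLast d n p.2).2) := by
      funext p
      exact chronFirst_succ n p
    rw [hcomp]
    refine ⟨h2.comp_measurePreserving hT, ?_⟩
    rw [← ih.2, ← h3, ← hT.map_eq, lintegral_map' _ hT.aemeasurable]
    · rfl
    · rw [hT.map_eq]
      exact h2.enorm.pow_const 2

/-- For every law `π` of the kick times, the chronological product of `n` reductions is measurable,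
its norm has mean square `‖η‖²`, and almost surely the next reduction may be applied to it. -/
theorem chronProduct_prod (hħ : 0 < ħ) (hU : IsUnitaryGroup ħ Ham U)
    (hW : ∀ ζ, StronglyMeasurable fun p => W p ζ) (f : PointerState d Λ) (η : H)
    (π : Measure KickTimes) [IsProbabilityMeasure π] (n : ℕ) :
    AEStronglyMeasurable (fun υ => chronProduct U (reductionG ħ W f) υ η n) (π.prod f.lawSeq) ∧
    ∫⁻ υ, ‖chronProduct U (reductionG ħ W f) υ η n‖ₑ ^ 2 ∂π.prod f.lawSeq = ‖η‖ₑ ^ 2 ∧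
    ∀ᵐ υ ∂π.prod f.lawSeq,
      InDomainG ħ W f (υ.2 n) (U (υ.1 n) (chronProduct U (reductionG ħ W f) υ η n)) := by
  obtain ⟨h1, h2⟩ := chronFirst_memLp hħ hU hW f η π n
  have hR : MeasurePreserving (fun υ : Trajectory d => (υ.1, (Finset.range n).restrict υ.2))
      (π.prod f.lawSeq) (π.prod (f.lawFirst n)) :=
    (MeasurePreserving.id π).prod ⟨Finset.measurable_restrict _, rfl⟩
  have hcomp : (fun υ => chronProduct U (reductionG ħ W f) υ η n) =
      chronFirst U (reductionG ħ W f) η n ∘ fun υ => (υ.1, (Finset.range n).restrict υ.2) := by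
    funext υ
    exact (chronFirst_restrict n υ).symm
  refine ⟨hcomp ▸ h1.comp_measurePreserving hR, ?_, ?_⟩
  · rw [← h2, ← hR.map_eq, lintegral_map' _ hR.aemeasurable]
    · simp only [chronFirst_restrict]
    · rw [hR.map_eq]
      exact h1.enorm.pow_const 2
  · have h3 := (reductionG_step hħ hU hW f h1
      ((measurable_kickTimes_apply n).comp measurable_fst)).1
    have hT := measurePreserving_prodAssoc_symm_comp (μ := π) (f.measurePreserving_restrict_eval n)
    filter_upwards [hT.quasiMeasurePreserving.ae h3] with υ hυ
    rwa [Function.comp_apply, chronFirst_restrict] at hυ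

/-- The case of given kick times, that is, of the law `δ_τ`. -/
theorem chronProduct_memLp (hħ : 0 < ħ) (hU : IsUnitaryGroup ħ Ham U)
    (hW : ∀ ζ, StronglyMeasurable fun p => W p ζ) (f : PointerState d Λ) (η : H)
    (τ : KickTimes) (n : ℕ) :
    MemLp (fun y => chronProduct U (reductionG ħ W f) (τ, y) η n) 2 f.lawSeq ∧
    ∫⁻ y, ‖chronProduct U (reductionG ħ W f) (τ, y) η n‖ₑ ^ 2 ∂f.lawSeq = ‖η‖ₑ ^ 2 := by
  obtain ⟨h1, h2, -⟩ := chronProduct_prod hħ hU hW f η (Measure.dirac τ) n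
  rw [Measure.dirac_prod] at h1 h2
  rw [lintegral_map' (h1.enorm.pow_const 2) measurable_prodMk_left.aemeasurable] at h2
  exact ⟨memLp_two_of_lintegral_ne_top (h1.comp_measurable measurable_prodMk_left)
    (by rw [h2]; exact ENNReal.pow_ne_top enorm_ne_top), h2⟩

/-- The chronological products are the states of the unitary evolution. The product of the first `n`
reductions does not depend on the pointer number `n`, so that `S` acts there on the state
`ζ ⊗ f₀`. -/
theorem isUnitaryEvolution_reducedWave (hħ : 0 < ħ) (hU : IsUnitaryGroup ħ Ham U)
    (hW : ∀ ζ, StronglyMeasurable fun p => W p ζ) (f : PointerState d Λ) (η : H)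
    (τ : KickTimes) (t : ℝ) :
    IsUnitaryEvolution ħ U W f η τ t fun y => reducedWave U (reductionG ħ W f) η t (τ, y) := by
  refine ⟨fun n y => chronProduct U (reductionG ħ W f) (τ, y) η n,
    fun n => (chronProduct_memLp hħ hU hW f η τ n).1, EventuallyEq.rfl, fun n => ?_,
    EventuallyEq.rfl⟩
  refine Eventually.of_forall fun y => ?_
  have h : ∀ z, chronProduct U (reductionG ħ W f) (τ, Function.update y n z) η n =
      chronProduct U (reductionG ħ W f) (τ, y) η n := fun z =>
    chronProduct_congr τ fun i hi => Function.update_of_ne hi.ne _ _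
  simp only [chronProduct, h, Function.update_self, LinearIsometryEquiv.apply_symm_apply]
  exact smul_reductionG_ae_eq hħ hW f _

theorem measurableSet_kickCount_eq (t : ℝ) (n : ℕ) :
    MeasurableSet {τ : KickTimes | kickCount τ t = n} := by
  simp only [kickCount_eq_iff]
  refine MeasurableSet.inter (s₁ := {τ : KickTimes | ∀ k < n, τ k < t}) (s₂ := {τ | t ≤ τ n}) ?_
    (measurableSet_le measurable_const (measurable_kickTimes_apply n))
  have : {τ : KickTimes | ∀ k < n, τ k < t} = ⋂ k, ⋂ _ : k < n, {τ | τ k < t} := by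
    ext τ
    simp
  rw [this]
  exact MeasurableSet.iInter fun k => MeasurableSet.iInter fun _ =>
    measurableSet_lt (measurable_kickTimes_apply k) measurable_const

theorem reducedWave_memLp (hħ : 0 < ħ) (hU : IsUnitaryGroup ħ Ham U)
    (hW : ∀ ζ, StronglyMeasurable fun p => W p ζ) (f : PointerState d Λ) (η : H)
    (π : Measure KickTimes) [IsProbabilityMeasure π] (t : ℝ) :
    MemLp (reducedWave U (reductionG ħ W f) η t) 2 (initialLaw π f) ∧
    ∫ υ, ‖reducedWave U (reductionG ħ W f) η t υ‖ ^ 2 ∂initialLaw π f = ‖η‖ ^ 2 := by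
  have hm : AEStronglyMeasurable (reducedWave U (reductionG ħ W f) η t) (initialLaw π f) := by
    have hcover : (⋃ n, {υ : Trajectory d | kickCount υ.1 t = n}) = univ := by
      ext υ
      simp
    rw [← Measure.restrict_univ (μ := initialLaw π f), ← hcover, aestronglyMeasurable_iUnion_iff]
    intro n
    refine (((U t).continuous.comp_aestronglyMeasurable
      (chronProduct_prod hħ hU hW f η π n).1).restrict
      (s := {υ : Trajectory d | kickCount υ.1 t = n})).congr ?_
    filter_upwards [ae_restrict_mem (measurable_fst (measurableSet_kickCount_eq t n))] with υ hυ
    rw [reducedWave, show kickCount υ.1 t = n from hυ]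
  have hn : ∫⁻ υ, ‖reducedWave U (reductionG ħ W f) η t υ‖ₑ ^ 2 ∂initialLaw π f = ‖η‖ₑ ^ 2 := by
    rw [initialLaw, lintegral_prod _ (hm.enorm.pow_const 2)]
    simp only [reducedWave, LinearIsometryEquiv.enorm_map,
      (chronProduct_memLp hħ hU hW f η _ _).2, lintegral_const, measure_univ, mul_one]
  refine ⟨memLp_two_of_lintegral_ne_top hm (by rw [hn]; exact ENNReal.pow_ne_top enorm_ne_top), ?_⟩
  rw [integral_eq_lintegral_of_nonneg_ae (Eventually.of_forall fun υ => sq_nonneg _)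
    (hm.norm.pow 2)]
  simp only [ENNReal.ofReal_pow (norm_nonneg _), ofReal_norm, hn]
  simp

end Random

end SpontLoc

end

open SpontLoc MeasureTheory in
theorem theorem2 {H : Type*} [NormedAddCommGroup H] [InnerProductSpace ℂ H] [CompleteSpace H]
    {d : ℕ} (ħ κ ν : ℝ) (hħ : 0 < ħ) (hκ : 0 < κ) (hν : 0 < ν)
    -- the Hamiltonian and `U t = exp (-(i/ħ) H t)`
    (Ham : H →ₗ.[ℂ] H) (hHam : IsSelfAdjoint Ham)
    (U : ℝ → (H ≃ₗᵢ[ℂ] H)) (hU : IsUnitaryGroup ħ Ham U)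
    -- the vector operator `R` and `V p s = exp (-(i/ħ) s (p · R))`
    (R : Fin d → (H →ₗ.[ℂ] H)) (hR : ∀ α, IsSelfAdjoint (R α))
    (V : EuclideanSpace ℝ (Fin d) → ℝ → (H ≃ₗᵢ[ℂ] H)) (hV : IsVectorExponential ħ R V)
    -- the pointer scale, the pointer state, the law of the kick times
    (Λ : PointerScale) (f : PointerState d Λ)
    (π₀ : Measure KickTimes) (hπ₀ : IsPoissonLaw ν π₀)
    (η : H) (hη : ‖η‖ = 1) :
    let W : EuclideanSpace ℝ (Fin d) → (H ≃ₗᵢ[ℂ] H) := fun p => V p κ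
    let G : EuclideanSpace ℝ (Fin d) → H → H := reductionG ħ W f
    let D : EuclideanSpace ℝ (Fin d) → H → Prop := InDomainG ħ W f
    let χ : ℝ → Trajectory d → H := reducedWave U G η
    -- `χ t` represents `⟨y|U(t, τ) (η ⊗ φ₀)`
    (∀ (τ : KickTimes) (t : ℝ), 0 ≤ t →
      IsUnitaryEvolution ħ U W f η τ t fun y => χ t (τ, y)) ∧
    -- normalization in mean square
    (∀ t : ℝ, 0 ≤ t → MemLp (χ t) 2 (initialLaw π₀ f) ∧
      ∫ υ, ‖χ t υ‖ ^ 2 ∂(initialLaw π₀ f) = 1) ∧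
    -- the stochastic wave equation, its integral form, and uniqueness of their solutions
    (∀ᵐ υ ∂(initialLaw π₀ f),
      SolvesWaveEquation ħ Ham D G η υ (fun t => χ t υ) ∧
      SolvesIntegralEquation U D G η υ (fun t => χ t υ) ∧
      (∀ x : ℝ → H, SolvesWaveEquation ħ Ham D G η υ x → ∀ t, 0 ≤ t → x t = χ t υ) ∧
      (∀ x : ℝ → H, SolvesIntegralEquation U D G η υ x → ∀ t, 0 ≤ t → x t = χ t υ)) := by
  intro W G D χ
  have hW : ∀ ζ, StronglyMeasurable fun p => W p ζ := fun ζ => hV.measurable κ ζ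
  have hP : IsProbabilityMeasure π₀ := hπ₀.isProbabilityMeasure
  refine ⟨fun τ t _ => isUnitaryEvolution_reducedWave hħ hU hW f η τ t, fun t _ => ?_, ?_⟩
  · have h := reducedWave_memLp hħ hU hW f η π₀ t
    rw [hη, one_pow] at h
    exact h
  · have hD : ∀ᵐ υ ∂initialLaw π₀ f, ∀ n, D (υ.2 n) (U (υ.1 n) (chronProduct U G υ η n)) :=
      ae_all_iff.2 fun n => (chronProduct_prod hħ hU hW f η π₀ n).2.2
    filter_upwards [hD] with υ hυ
    exact ⟨hU.solvesWaveEquation_reducedWave hυ, solvesIntegralEquation_reducedWave hυ,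
      fun x hx t ht => hU.eq_reducedWave_of_solvesWaveEquation hHam.dense_domain hx ht,
      fun x hx t ht => hx.eq_reducedWave ht⟩
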